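/- **Theorem (SOS truncations of the Stokes-constrained slice-volume program converge).** Let $n\ge 1$, $R\in[0,\infty)$, and let $g_1,\dots,g_N\in\mathbb{R}[x]$, $x=(x_1,\dots,x_n)$, be polynomials describing the basic semialgebraic set $L=\{x\in\mathbb{R}^n\mid g_i(x)\ge 0,\ i=1,\dots,N\}$. Assume: * (A1) $L\subseteq B_R^n$, where $B_R^d=\{x\in\mathbb{R}^d\mid \|x\|_2\le R\}$; * (A2) one of the $g_i$ is the ball constraint $R^2-\|x\|_2^2$; * (A3) $\operatorname{int}(L)$ is a standard domain. Here a bounded open connected set $S\subset\mathbb{R}^n$ (the empty set is allowed) with $\Delta=\operatorname{cl}(S)\setminus S$ is a standard domain if there is $Q\subseteq\Delta$ of zero $(n-1)$-dimensional Hausdorff measure such that every $p\in\Delta\setminus Q$ has an open neighbourhood in which, in suitable orthogonal coordinates $x=M\alpha$, $M\in O(n)$, the set $\Delta$ is the graph $\alpha_1=h(\alpha_2,\dots,\alpha_n)$ of a $C^1$ function $h$ and $S$ is the set $\alpha_1>h(\alpha_2,\dots,\alpha_n)$; * (A4) for each $i$, $\nabla g_i(x)\ne 0$ at every $x\in L$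 with $g_i(x)=0$. Let $$\Omega_Z=\{(\theta,t,Z)\in S^{n-1}\times[-R,R]\times\mathbb{R}^{n\times(n-1)}\mid[\theta,Z]\in O(n)\},\qquad \Psi=\Omega_Z\times B_R^{n-1},$$ $$\Psi_L=\{(\theta,t,Z,y)\in\Psi\mid \theta t+Zy\in L\},\qquad \Psi_L^i=\{(\theta,t,Z,y)\in\Psi_L\mid g_i(\theta t+Zy)=0\},$$ and $\Lambda_Rw(\theta,t,Z)=\int_{B_R^{n-1}}w(\theta,t,Z,y)\,dy$. Let $p^*$ be the infimum of $\gamma\in\mathbb{R}$ over all $\gamma$ and $w\in C(\Psi)$ with $\gamma\ge\Lambda_Rw$ on $\Omega_Z$, $w\ge1$ on $\Psi_L$ and $w\ge0$ on $\Psi$. For a set $K=\{z\mid a_i(z)\ge0,\ b_j(z)=0\}$ described by finitely many polynomials, $\Sigma[K]_{\le2k}$ denotes the set of polynomials $\sigma_0+\sum_i\sigma_ia_i+\sum_j\phi_jb_j$ with $\sigma_0,\sigma_i$ sums of squares of polynomials, $\phi_j$ arbitrary polynomials, and $\deg\sigma_0,\deg\sigma_ia_i,\deg\phi_jb_j\le2k$.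 The descriptions used are: for $\Omega_Z$, $R^2-t^2\ge0$ and the entries of $[\theta,Z]^T[\theta,Z]-I=0$; for $\Psi$, additionally $R^2-\|y\|_2^2\ge0$; for $\Psi_L$, additionally $g_i(\theta t+Zy)\ge0$ for all $i$; for $\Psi_L^i$, additionally $g_i(\theta t+Zy)=0$. Write $[f]_G(z)=\tfrac12\big(f(z)+f(-z)\big)$ for $z=(\theta,t,Z,y)$. For $k\in\mathbb{N}$ let $p^*_{s,k}\in[-\infty,+\infty]$ be the infimum of $\gamma\in\mathbb{R}$ over all $\gamma$, all $w\in\mathbb{R}[\theta,t,Z,y]_{\le2k}$ and all $u\in\big(\mathbb{R}[\theta,t,Z,y]_{\le 2k-2\max_i\deg g_i}\big)^{n-1}$ such that $$\gamma-\Lambda_Rw\in\Sigma[\Omega_Z]_{\le2k},\qquad w-1-[\nabla_y\cdot u]_G\in\Sigma[\Psi_L]_{\le2k},$$ $$-[u\cdot\nabla_y\,g_i(\theta t+Zy)]_G\in\Sigma[\Psi_L^i]_{\le2k}\ \ (i=1,\dots,N),\qquad w\in\Sigma[\Psi]_{\le2k}$$ (with $+\infty$ if there are none; a polynomial space of negative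 degree is $\{0\}$). Then $$\lim_{k\to\infty}p^*_{s,k}=p^*.$$ -/

import Mathlib

open MeasureTheory Set Filter Topology
open scoped Matrix

namespace SliceVolume

noncomputable section

/-! Points of `ℝⁿ`, with `n = m + 1`, are functions `Fin (m + 1) → ℝ`; hyperplanes of `ℝⁿ` carry
local coordinates `y : Fin m → ℝ`.  The Euclidean norm is always written out as a sum of squares. -/

/-- The Euclidean ball `B_R` of radius `R` (for `R ≥ 0`) around the origin. -/
def ball (d : ℕ) (R : ℝ) : Set (Fin d → ℝ) := {x | ∑ i, x i ^ 2 ≤ R ^ 2}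

/-- The basic semialgebraic set `L = {x | g i x ≥ 0 for all i}`. -/
def basicSet {d N : ℕ} (g : Fin N → MvPolynomial (Fin d) ℝ) : Set (Fin d → ℝ) :=
  {x | ∀ i, 0 ≤ MvPolynomial.eval x (g i)}

/-- Standard domains: bounded open connected sets whose boundary, off a set `Q` of zero
`(n - 1)`-dimensional Hausdorff measure, is locally the graph of a `C¹` function `h` in rotated
coordinates `x = M α`, `M ∈ O(n)`, with the domain lying on the side `α₀ > h (α₁, …, α_m)`.
(The empty set is admitted.) -/
structure IsStandardDomain {m : ℕ} (S : Set (Fin (m + 1) → ℝ)) : Prop where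
  bounded : Bornology.IsBounded S
  isOpen : IsOpen S
  connected : IsPreconnected S
  boundary : ∃ Q ⊆ closure S \ S,
    Measure.hausdorffMeasure (m : ℝ)
      ((WithLp.toLp 2 : (Fin (m + 1) → ℝ) → EuclideanSpace ℝ (Fin (m + 1))) '' Q) = 0 ∧
    ∀ p ∈ (closure S \ S) \ Q,
      ∃ M ∈ Matrix.orthogonalGroup (Fin (m + 1)) ℝ,
      ∃ N : Set (Fin (m + 1) → ℝ), IsOpen N ∧ p ∈ N ∧
      ∃ h : (Fin m → ℝ) → ℝ,
        ContDiffOn ℝ 1 h {v | ∃ a : ℝ, M *ᵥ (Fin.cons a v : Fin (m + 1) → ℝ) ∈ N} ∧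
        ∀ α : Fin (m + 1) → ℝ, M *ᵥ α ∈ N →
          ((M *ᵥ α ∈ closure S \ S ↔ α 0 = h (Fin.tail α)) ∧
            (M *ᵥ α ∈ S ↔ h (Fin.tail α) < α 0))

/-! ### Variables -/

/-- The variables `(θ, t, Z)`: the direction `θ ∈ ℝⁿ`, the offset `t ∈ ℝ` and the frame
`Z ∈ ℝ^(n × (n - 1))`. -/
abbrev FrameVar (m : ℕ) : Type := (Fin (m + 1) ⊕ Unit) ⊕ (Fin (m + 1) × Fin m)

/-- The variables `(θ, t, Z, y)`. -/
abbrev SliceVar (m : ℕ) : Type := FrameVar m ⊕ Fin m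

/-- The variable `θ_i`. -/
def thetaVar {m : ℕ} (i : Fin (m + 1)) : FrameVar m := Sum.inl (Sum.inl i)

/-- The variable `t`. -/
def offsetVar {m : ℕ} : FrameVar m := Sum.inl (Sum.inr ())

/-- The variable `Z_ij`. -/
def frameVar {m : ℕ} (i : Fin (m + 1)) (j : Fin m) : FrameVar m := Sum.inr (i, j)

/-- The variable `y_j`. -/
def coordVar {m : ℕ} (j : Fin m) : SliceVar m := Sum.inr j

/-- The point `(θ, t, Z, y)` with `q = (θ, t, Z)`. -/
def joinPoint {m : ℕ} (q : FrameVar m → ℝ) (y : Fin m → ℝ) : SliceVar m → ℝ := Sum.elim q y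

/-- The `(θ, t, Z)` part of the point `(θ, t, Z, y)`. -/
def framePart {m : ℕ} (z : SliceVar m → ℝ) : FrameVar m → ℝ := fun v => z (Sum.inl v)

/-- The `y` part of the point `(θ, t, Z, y)`. -/
def coordPart {m : ℕ} (z : SliceVar m → ℝ) : Fin m → ℝ := fun j => z (coordVar j)

/-- The square matrix `[θ, Z]`, with first column `θ`. -/
def frameMatrix {m : ℕ} {A : Type*} (q : FrameVar m → A) : Matrix (Fin (m + 1)) (Fin (m + 1)) A :=
  Matrix.of fun i => Fin.cons (q (thetaVar i)) (fun j => q (frameVar i j))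

/-- The point `θ t + Z y` of `ℝⁿ` (or the vector of polynomials with these entries). -/
def slicePoint {m : ℕ} {A : Type*} [CommSemiring A] (z : SliceVar m → A) : Fin (m + 1) → A :=
  fun i => z (Sum.inl (thetaVar i)) * z (Sum.inl offsetVar) +
    ∑ j, z (Sum.inl (frameVar i j)) * z (coordVar j)

/-! ### Support sets -/

/-- `Ω_Z`: the `(θ, t, Z)` with `‖θ‖ = 1`, `t ∈ [-R, R]` and `[θ, Z] ∈ O(n)`. -/
def OmegaZ (m : ℕ) (R : ℝ) : Set (FrameVar m → ℝ) :=
  {q | ∑ i, q (thetaVar i) ^ 2 = 1 ∧ q offsetVar ∈ Icc (-R) R ∧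
    frameMatrix q ∈ Matrix.orthogonalGroup (Fin (m + 1)) ℝ}

/-- `Ψ = Ω_Z × B_R^(n-1)`. -/
def Psi (m : ℕ) (R : ℝ) : Set (SliceVar m → ℝ) :=
  {z | framePart z ∈ OmegaZ m R ∧ coordPart z ∈ ball m R}

/-- `Ψ_L`: the points of `Ψ` with `θ t + Z y ∈ L`. -/
def PsiL {m : ℕ} (R : ℝ) (L : Set (Fin (m + 1) → ℝ)) : Set (SliceVar m → ℝ) :=
  {z | z ∈ Psi m R ∧ slicePoint z ∈ L}

/-- The `y`-integration `Λ_R w (θ, t, Z) = ∫_{B_R^(n-1)} w (θ, t, Z, y) dy`. -/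
def Lam {m : ℕ} (R : ℝ) (w : (SliceVar m → ℝ) → ℝ) (q : FrameVar m → ℝ) : ℝ :=
  ∫ y in ball m R, w (joinPoint q y)

/-! ### The linear program over continuous functions -/

/-- The pair `(γ, w)` is feasible for the slice-volume function program. -/
structure Feasible {m : ℕ} (R : ℝ) (L : Set (Fin (m + 1) → ℝ)) (γ : ℝ)
    (w : (SliceVar m → ℝ) → ℝ) : Prop where
  integral_le : ∀ q ∈ OmegaZ m R, Lam R w q ≤ γ
  one_le : ∀ z ∈ PsiL R L, 1 ≤ w z
  nonneg : ∀ z ∈ Psi m R, 0 ≤ w z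
  continuousOn : ContinuousOn w (Psi m R)

/-- The optimal value `p*` of the slice-volume function program. -/
def pStar {m : ℕ} (R : ℝ) (L : Set (Fin (m + 1) → ℝ)) : EReal :=
  sInf {c : EReal | ∃ (γ : ℝ) (w : (SliceVar m → ℝ) → ℝ), Feasible R L γ w ∧ c = (γ : EReal)}

/-! ### Weighted sums of squares -/

/-- The degree-restricted weighted sum-of-squares cone `Σ[K]_{≤ 2k}` of the set
`K = {g a ≥ 0 for all a, h b = 0 for all b}` (with respect to this description):
sum-of-squares multipliers for the inequalities, free multipliers for the equations. -/
def WSOS {V I J : Type*} [Fintype I] [Fintype J] (g : I → MvPolynomial V ℝ)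
    (h : J → MvPolynomial V ℝ) (k : ℕ) : Set (MvPolynomial V ℝ) :=
  {p | ∃ (s₀ : MvPolynomial V ℝ) (s : I → MvPolynomial V ℝ) (f : J → MvPolynomial V ℝ),
    IsSumSq s₀ ∧ s₀.totalDegree ≤ 2 * k ∧
    (∀ a, IsSumSq (s a) ∧ (s a * g a).totalDegree ≤ 2 * k) ∧
    (∀ b, (f b * h b).totalDegree ≤ 2 * k) ∧
    p = s₀ + ∑ a, s a * g a + ∑ b, f b * h b}

/-- The equations `[θ, Z]ᵀ [θ, Z] = I`, entry by entry. -/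
def orthEq (m : ℕ) (e : Fin (m + 1) × Fin (m + 1)) : MvPolynomial (FrameVar m) ℝ :=
  ((frameMatrix MvPolynomial.X)ᵀ * frameMatrix MvPolynomial.X - 1 :
    Matrix (Fin (m + 1)) (Fin (m + 1)) (MvPolynomial (FrameVar m) ℝ)) e.1 e.2

/-- The inequality `R² - t² ≥ 0`. -/
def offsetIneq (m : ℕ) (R : ℝ) : MvPolynomial (FrameVar m) ℝ :=
  MvPolynomial.C (R ^ 2) - MvPolynomial.X offsetVar ^ 2

/-- A polynomial in `(θ, t, Z)` as a polynomial in `(θ, t, Z, y)`. -/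
def lift {m : ℕ} (p : MvPolynomial (FrameVar m) ℝ) : MvPolynomial (SliceVar m) ℝ :=
  MvPolynomial.rename Sum.inl p

/-- The polynomial `g (θ t + Z y)`. -/
def pull {m : ℕ} (g : MvPolynomial (Fin (m + 1)) ℝ) : MvPolynomial (SliceVar m) ℝ :=
  MvPolynomial.bind₁ (slicePoint MvPolynomial.X) g

/-- The inequalities describing `Ψ`: `R² - t² ≥ 0` and `R² - ‖y‖² ≥ 0`. -/
def psiIneq (m : ℕ) (R : ℝ) : Fin 2 → MvPolynomial (SliceVar m) ℝ :=
  ![lift (offsetIneq m R),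
    MvPolynomial.C (R ^ 2) - ∑ j : Fin m, MvPolynomial.X (coordVar j) ^ 2]

/-- The inequalities describing `Ψ_L`: those of `Ψ` and `g i (θ t + Z y) ≥ 0`. -/
def psiLIneq {m N : ℕ} (R : ℝ) (g : Fin N → MvPolynomial (Fin (m + 1)) ℝ) :
    Fin 2 ⊕ Fin N → MvPolynomial (SliceVar m) ℝ :=
  Sum.elim (psiIneq m R) (fun i => pull (g i))

/-- `Σ[Ω_Z]_{≤ 2k}`. -/
def sosOmegaZ (m : ℕ) (R : ℝ) (k : ℕ) : Set (MvPolynomial (FrameVar m) ℝ) :=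
  WSOS (fun _ : Unit => offsetIneq m R) (orthEq m) k

/-- `Σ[Ψ]_{≤ 2k}`. -/
def sosPsi (m : ℕ) (R : ℝ) (k : ℕ) : Set (MvPolynomial (SliceVar m) ℝ) :=
  WSOS (psiIneq m R) (fun e => lift (orthEq m e)) k

/-- `Σ[Ψ_L]_{≤ 2k}`. -/
def sosPsiL {m N : ℕ} (R : ℝ) (g : Fin N → MvPolynomial (Fin (m + 1)) ℝ) (k : ℕ) :
    Set (MvPolynomial (SliceVar m) ℝ) :=
  WSOS (psiLIneq R g) (fun e => lift (orthEq m e)) k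

/-- `Σ[Ψ_L^i]_{≤ 2k}`, where `Ψ_L^i` is the part of `Ψ_L` on which `g i (θ t + Z y) = 0`. -/
def sosPsiLFace {m N : ℕ} (R : ℝ) (g : Fin N → MvPolynomial (Fin (m + 1)) ℝ) (i : Fin N)
    (k : ℕ) : Set (MvPolynomial (SliceVar m) ℝ) :=
  WSOS (psiLIneq R g)
    (Sum.elim (fun e => lift (orthEq m e)) (fun _ : Unit => pull (g i))) k

/-! ### The Stokes-constrained sum-of-squares program -/

/-- The group average `[f]_G (z) = (f z + f (-z)) / 2` over the reflection
`(θ, t, Z, y) ↦ -(θ, t, Z, y)`. -/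
def symm {m : ℕ} (f : MvPolynomial (SliceVar m) ℝ) : MvPolynomial (SliceVar m) ℝ :=
  MvPolynomial.C (1 / 2) * (f + MvPolynomial.bind₁ (fun v => -MvPolynomial.X v) f)

/-- The divergence `∇_y · u`. -/
def divY {m : ℕ} (u : Fin m → MvPolynomial (SliceVar m) ℝ) : MvPolynomial (SliceVar m) ℝ :=
  ∑ j, MvPolynomial.pderiv (coordVar j) (u j)

/-- The polynomial `u · ∇_y (g (θ t + Z y))`. -/
def dotGradY {m : ℕ} (u : Fin m → MvPolynomial (SliceVar m) ℝ)
    (g : MvPolynomial (Fin (m + 1)) ℝ) : MvPolynomial (SliceVar m) ℝ :=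
  ∑ j, u j * MvPolynomial.pderiv (coordVar j) (pull g)

/-- The maximal degree of the describing polynomials. -/
def maxDegree {d N : ℕ} (g : Fin N → MvPolynomial (Fin d) ℝ) : ℕ :=
  Finset.univ.sup fun i => (g i).totalDegree

/-- The triple `(γ, w, u)` is feasible for the degree-`k` sum-of-squares truncation of the
Stokes-constrained program.  The polynomial `q` is `γ - Λ_R w`.  The last field says that `u j` has
degree at most `2 k - 2 max deg g`, the zero polynomial having degree `-∞`. -/
structure StokesSOSFeasible {m N : ℕ} (R : ℝ) (g : Fin N → MvPolynomial (Fin (m + 1)) ℝ) (k : ℕ)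
    (γ : ℝ) (w : MvPolynomial (SliceVar m) ℝ) (u : Fin m → MvPolynomial (SliceVar m) ℝ) :
    Prop where
  integral_le : ∃ q ∈ sosOmegaZ m R k, ∀ x : FrameVar m → ℝ,
    MvPolynomial.eval x q = γ - Lam R (fun z => MvPolynomial.eval z w) x
  stokes : w - 1 - symm (divY u) ∈ sosPsiL R g k
  boundary : ∀ i, -symm (dotGradY u (g i)) ∈ sosPsiLFace R g i k
  nonneg : w ∈ sosPsi m R k
  degree_w : w.totalDegree ≤ 2 * k
  degree_u : ∀ j, u j = 0 ∨ (u j).totalDegree + 2 * maxDegree g ≤ 2 * k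

/-- The optimal value `p*_{s,k}` of the degree-`k` sum-of-squares truncation of the
Stokes-constrained program (`+∞` if it is infeasible). -/
def pStarStokesSOS {m N : ℕ} (R : ℝ) (g : Fin N → MvPolynomial (Fin (m + 1)) ℝ) (k : ℕ) : EReal :=
  sInf {c : EReal | ∃ (γ : ℝ) (w : MvPolynomial (SliceVar m) ℝ)
    (u : Fin m → MvPolynomial (SliceVar m) ℝ), StokesSOSFeasible R g k γ w u ∧ c = (γ : EReal)}

end

end SliceVolume

/-! The upper bound and the lower bound have different sources.

Upper bound, for large `k`. Take `u = 0`. Given a feasible pair for the continuous program, raise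
`w` slightly and approximate it uniformly on the compact set `Ψ` by a polynomial, so that every
constraint becomes strict. Putinar's Positivstellensatz then supplies the certificates. It is proved
here for Archimedean quadratic modules: an element outside the module is nonpositive under some
state, a state minimising it can be chosen extreme, extreme states are multiplicative, and on
polynomials they are therefore point evaluations (`state_sq_mul_le`, `map_mul_of_extreme`,
`mem_of_forall_hom_pos`).

Lower bound, for every `k`. Both programs are compared with the volumes of the slices. By a Dini
argument, `p*` is at most any bound on all slice volumes (`pStar_le`). Conversely, any feasible `γ`
of the truncation is such a bound (`volume_slice_le`): integrating `w ≥ 1 + div v` over a slice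
gives the claim once the divergence is known to have nonnegative integral. Here `v` is the odd part
of `u`, because symmetrising the constraints amounts to that replacement.

The difficulty is that a hyperplane may be tangent to a face of `L`, so that the boundary of the
slice is singular. Two facts resolve this. First, `v` vanishes at tangencies
(`eval_eq_zero_of_tangent`): rotating the frame about the fixed boundary point in either direction
reverses the sign of the tangential gradient, and the boundary inequality holds on both sides.
Second, a field that is outward at regular boundary points and zero at singular ones satisfies the
divergence inequality (`integral_div_nonneg`). Its proof uses smooth cutoffs: the error comes from
thin slabs `0 ≤ G ≤ ε`, over which the integral of `|∂G|` is `O(ε)`, because a polynomial on a line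
has boundedly many monotone pieces. -/

namespace SliceVolume

/-! ### Archimedean quadratic modules -/

/-- Quadratic modules of a commutative `ℝ`-algebra. -/
structure IsQuadraticModule {A : Type*} [CommRing A] [Algebra ℝ A] (M : Set A) : Prop where
  one_mem : (1 : A) ∈ M
  add_mem : ∀ {p q}, p ∈ M → q ∈ M → p + q ∈ M
  sq_mul_mem : ∀ (a : A) {p}, p ∈ M → a ^ 2 * p ∈ M

namespace IsQuadraticModule

variable {A : Type*} [CommRing A] [Algebra ℝ A] {M : Set A}

theorem smul_mem (hM : IsQuadraticModule M) {c : ℝ} (hc : 0 ≤ c) {p : A} (hp : p ∈ M) :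
    c • p ∈ M := by
  have h := hM.sq_mul_mem (algebraMap ℝ A (Real.sqrt c)) hp
  rwa [← map_pow, Real.sq_sqrt hc, ← Algebra.smul_def] at h

theorem sq_mem (hM : IsQuadraticModule M) (a : A) : a ^ 2 ∈ M := by
  simpa using hM.sq_mul_mem a hM.one_mem

theorem zero_mem (hM : IsQuadraticModule M) : (0 : A) ∈ M := by
  simpa using hM.sq_mem 0

theorem algebraMap_mem (hM : IsQuadraticModule M) {c : ℝ} (hc : 0 ≤ c) :
    algebraMap ℝ A c ∈ M := by
  simpa [Algebra.smul_def] using hM.smul_mem hc hM.one_mem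

/-- An element is bounded with respect to `M` if some `c ± a` lie in `M`. -/
def Bounded (M : Set A) (a : A) : Prop :=
  ∃ c : ℝ, 0 < c ∧ algebraMap ℝ A c - a ∈ M ∧ algebraMap ℝ A c + a ∈ M

theorem bounded_algebraMap (hM : IsQuadraticModule M) (r : ℝ) : Bounded M (algebraMap ℝ A r) := by
  refine ⟨|r| + 1, by positivity, ?_, ?_⟩
  · rw [← map_sub]; exact hM.algebraMap_mem (by linarith [le_abs_self r])
  · rw [← map_add]; exact hM.algebraMap_mem (by linarith [neg_abs_le r])

theorem Bounded.add (hM : IsQuadraticModule M) {a b : A} (ha : Bounded M a) (hb : Bounded M b) :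
    Bounded M (a + b) := by
  obtain ⟨c, hc, h1, h2⟩ := ha
  obtain ⟨d, hd, h3, h4⟩ := hb
  refine ⟨c + d, by positivity, ?_, ?_⟩
  · convert hM.add_mem h1 h3 using 1; rw [map_add]; ring
  · convert hM.add_mem h2 h4 using 1; rw [map_add]; ring

theorem Bounded.smul (hM : IsQuadraticModule M) {a : A} (ha : Bounded M a) (r : ℝ) :
    Bounded M (r • a) := by
  obtain ⟨c, hc, h1, h2⟩ := ha
  rcases le_total 0 r with hr | hr
  · refine ⟨r * c + 1, by positivity, ?_, ?_⟩
    · convert hM.add_mem (hM.smul_mem hr h1) hM.one_mem using 1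
      simp only [Algebra.smul_def, map_add, map_mul, map_one]; ring
    · convert hM.add_mem (hM.smul_mem hr h2) hM.one_mem using 1
      simp only [Algebra.smul_def, map_add, map_mul, map_one]; ring
  · have hr' : 0 ≤ -r := by linarith
    refine ⟨-r * c + 1, by positivity, ?_, ?_⟩
    · convert hM.add_mem (hM.smul_mem hr' h2) hM.one_mem using 1
      simp only [Algebra.smul_def, map_add, map_mul, map_one, map_neg]; ring
    · convert hM.add_mem (hM.smul_mem hr' h1) hM.one_mem using 1
      simp only [Algebra.smul_def, map_add, map_mul, map_one, map_neg]; ring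

theorem Bounded.sq (hM : IsQuadraticModule M) {a : A} (ha : Bounded M a) : Bounded M (a ^ 2) := by
  obtain ⟨c, hc, h1, h2⟩ := ha
  refine ⟨c ^ 2, by positivity, ?_, ?_⟩
  -- A quadratic module need not contain `(c - a)(c + a)`; but `(c + a)²(c - a) + (c - a)²(c + a) =
  -- 2c(c² - a²)`.
  · have h := hM.smul_mem (c := 1 / (2 * c)) (by positivity)
      (hM.add_mem (hM.sq_mul_mem (algebraMap ℝ A c + a) h1)
        (hM.sq_mul_mem (algebraMap ℝ A c - a) h2))
    convert h using 1
    have e : (algebraMap ℝ A c + a) ^ 2 * (algebraMap ℝ A c - a) +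
        (algebraMap ℝ A c - a) ^ 2 * (algebraMap ℝ A c + a) =
        (2 * c) • (algebraMap ℝ A (c ^ 2) - a ^ 2) := by
      simp only [Algebra.smul_def, map_pow, map_mul, map_ofNat]; ring
    rw [e, smul_smul, one_div, inv_mul_cancel₀ (by positivity), one_smul]
  · exact hM.add_mem (hM.algebraMap_mem (by positivity)) (hM.sq_mem a)

/-- Polarisation, `4ab = (a + b)² - (a - b)²`. Bounded elements thus form a subalgebra, and
boundedness need only be checked on generators. -/
theorem Bounded.mul (hM : IsQuadraticModule M) {a b : A} (ha : Bounded M a) (hb : Bounded M b) :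
    Bounded M (a * b) := by
  have h := ((ha.add hM hb).sq hM).add hM (((ha.add hM (hb.smul hM (-1))).sq hM).smul hM (-1))
  convert h.smul hM (1 / 4) using 1
  have e : (a + b) ^ 2 + (-1 : ℝ) • (a + (-1 : ℝ) • b) ^ 2 = (4 : ℝ) • (a * b) := by
    simp only [Algebra.smul_def, map_neg, map_one, map_ofNat]; ring
  rw [e, smul_smul]; norm_num

theorem bounded_of_sq (hM : IsQuadraticModule M) {a : A} {c : ℝ}
    (h : algebraMap ℝ A c - a ^ 2 ∈ M) : Bounded M a := by
  have key : ∀ b : A, b ^ 2 = a ^ 2 → algebraMap ℝ A (|c| + 1) - b ∈ M := by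
    intro b hb
    -- Completing the square: `(c - b²) + (b - 1/2)² = c + 1/4 - b`; the last summand adjusts the
    -- constant.
    have h1 := hM.add_mem (hM.add_mem h (hM.sq_mem (b - algebraMap ℝ A (1 / 2))))
      (hM.algebraMap_mem (c := |c| + 1 - c - 1 / 4) (by linarith [le_abs_self c]))
    convert h1 using 1
    have e2 : algebraMap ℝ A (1 / 2) * 2 = 1 := by
      rw [← map_ofNat (algebraMap ℝ A) 2, ← map_mul]; norm_num
    have e4 : algebraMap ℝ A (1 / 4) = algebraMap ℝ A (1 / 2) ^ 2 := by
      rw [← map_pow]; norm_num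
    simp only [map_sub, map_add, e4, map_one]
    linear_combination (-1) * hb + b * e2
  refine ⟨|c| + 1, by positivity, key a rfl, ?_⟩
  have := key (-a) (by ring)
  rwa [sub_neg_eq_add] at this

/-- The states of `M`: normalised linear functionals that are nonnegative on `M`. -/
def states (M : Set A) : Set (A → ℝ) :=
  {φ | (∀ a b, φ (a + b) = φ a + φ b) ∧ (∀ (r : ℝ) a, φ (r • a) = r * φ a) ∧ φ 1 = 1 ∧
    ∀ p ∈ M, 0 ≤ φ p}

theorem isClosed_states (M : Set A) : IsClosed (states M) := by
  have e : states M = (⋂ a, ⋂ b, {φ : A → ℝ | φ (a + b) = φ a + φ b}) ∩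
      ((⋂ r : ℝ, ⋂ a, {φ : A → ℝ | φ (r • a) = r * φ a}) ∩ ({φ : A → ℝ | φ 1 = 1} ∩
        ⋂ p ∈ M, {φ : A → ℝ | 0 ≤ φ p})) := by
    ext φ; simp [states]
  rw [e]
  refine .inter (isClosed_iInter fun a => isClosed_iInter fun b => ?_) (.inter
    (isClosed_iInter fun r => isClosed_iInter fun a => ?_) (.inter ?_
      (isClosed_iInter fun p => isClosed_iInter fun _ => ?_)))
  · exact isClosed_eq (by fun_prop) (by fun_prop)
  · exact isClosed_eq (by fun_prop) (by fun_prop)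
  · exact isClosed_eq (by fun_prop) (by fun_prop)
  · exact isClosed_le (by fun_prop) (by fun_prop)

theorem states_sub {φ : A → ℝ} (hφ : φ ∈ states M) (a b : A) : φ (a - b) = φ a - φ b := by
  have h := hφ.1 (a - b) b
  rw [sub_add_cancel] at h; linarith

theorem states_algebraMap {φ : A → ℝ} (hφ : φ ∈ states M) (r : ℝ) : φ (algebraMap ℝ A r) = r := by
  rw [Algebra.algebraMap_eq_smul_one, hφ.2.1, hφ.2.2.1, mul_one]

/-- Tychonoff: boundedness of `a` confines `φ a` to an interval independent of the state `φ`. -/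
theorem isCompact_states (hB : ∀ a : A, Bounded M a) : IsCompact (states M) := by
  choose c hc h1 h2 using hB
  refine IsCompact.of_isClosed_subset (isCompact_univ_pi fun a => isCompact_Icc (a := -c a)
    (b := c a)) (isClosed_states M) fun φ hφ a _ => ?_
  have e1 := hφ.2.2.2 _ (h1 a)
  have e2 := hφ.2.2.2 _ (h2 a)
  rw [states_sub hφ, states_algebraMap hφ] at e1
  rw [hφ.1, states_algebraMap hφ] at e2
  constructor <;> linarith

/-- The product `(c - f²)p` need not lie in `M`, so a growth argument replaces it: the moments
`φ(f^(2k) p)` are log-convex in `k` and at most `d c^k`, so their first ratio cannot exceed `c`. -/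
theorem state_sq_mul_le (hM : IsQuadraticModule M) {φ : A → ℝ} (hφ : φ ∈ states M)
    {f p : A} {c : ℝ} (hc : 0 < c) (hf : algebraMap ℝ A c - f ^ 2 ∈ M) (hp : p ∈ M)
    (hpB : Bounded M p) : φ (f ^ 2 * p) ≤ c * φ p := by
  set a : ℕ → ℝ := fun k => φ (f ^ (2 * k) * p) with ha
  have ha0 : ∀ k, 0 ≤ a k := fun k => by
    have := hφ.2.2.2 _ (hM.sq_mul_mem (f ^ k) hp)
    rwa [← pow_mul, mul_comm k 2] at this
  have hpow : ∀ k, φ (f ^ (2 * k)) ≤ c ^ k := by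
    intro k
    induction k with
    | zero => simp [hφ.2.2.1]
    | succ k ih =>
      have h := hφ.2.2.2 _ (hM.sq_mul_mem (f ^ k) hf)
      have e : (f ^ k) ^ 2 * (algebraMap ℝ A c - f ^ 2) = c • f ^ (2 * k) - f ^ (2 * (k + 1)) := by
        rw [Algebra.smul_def]; ring
      rw [e, states_sub hφ, hφ.2.1] at h
      calc φ (f ^ (2 * (k + 1))) ≤ c * φ (f ^ (2 * k)) := by linarith
        _ ≤ c * c ^ k := by gcongr
        _ = c ^ (k + 1) := by ring
  obtain ⟨d, hd, hd1, -⟩ := hpB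
  have hup : ∀ k, a k ≤ d * c ^ k := by
    intro k
    have h := hφ.2.2.2 _ (hM.sq_mul_mem (f ^ k) hd1)
    have e : (f ^ k) ^ 2 * (algebraMap ℝ A d - p) = d • f ^ (2 * k) - f ^ (2 * k) * p := by
      rw [Algebra.smul_def]; ring
    rw [e, states_sub hφ, hφ.2.1] at h
    calc a k ≤ d * φ (f ^ (2 * k)) := by simp only [ha]; linarith
      _ ≤ d * c ^ k := by have := hpow k; gcongr
  -- Cauchy–Schwarz, as the discriminant of `x ↦ φ((x f^k - f^(k+2))² p) ≥ 0`.
  have hconv : ∀ k, a (k + 1) ^ 2 ≤ a k * a (k + 2) := by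
    intro k
    have h : ∀ x : ℝ, 0 ≤ a k * (x * x) + (-2 * a (k + 1)) * x + a (k + 2) := by
      intro x
      have h1 := hφ.2.2.2 _ (hM.sq_mul_mem (x • f ^ k - f ^ (k + 2)) hp)
      have e : (x • f ^ k - f ^ (k + 2)) ^ 2 * p = (x * x) • (f ^ (2 * k) * p) +
          ((-2 * x) • (f ^ (2 * (k + 1)) * p) + f ^ (2 * (k + 2)) * p) := by
        simp only [Algebra.smul_def, map_mul, map_neg, map_ofNat]; ring
      rw [e, hφ.1, hφ.1, hφ.2.1, hφ.2.1] at h1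
      simp only [ha]; linarith
    have := discrim_le_zero h
    rw [discrim] at this
    nlinarith
  by_contra hcon
  have h01 : c * a 0 < a 1 := by simpa [ha] using hcon
  have ha0pos : 0 < a 0 := by
    refine lt_of_le_of_ne (ha0 0) fun h => ?_
    have h1 := hconv 0
    rw [← h] at h1 h01
    nlinarith
  -- Log-convexity makes the ratios nondecreasing, so `a k ≥ ρ^k a 0` with `ρ > c`, which eventually
  -- exceeds `d c^k`.
  set ρ := a 1 / a 0 with hρ
  have hcρ : c < ρ := by rwa [hρ, lt_div_iff₀ ha0pos]
  have hρpos : 0 < ρ := hc.trans hcρ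
  have hind : ∀ k, 0 < a k ∧ ρ * a k ≤ a (k + 1) := by
    intro k
    induction k with
    | zero => exact ⟨ha0pos, by rw [hρ, div_mul_cancel₀ _ ha0pos.ne']⟩
    | succ k ih =>
      have hpos : 0 < a (k + 1) := lt_of_lt_of_le (mul_pos hρpos ih.1) ih.2
      refine ⟨hpos, ?_⟩
      have h1 := hconv k
      have h2 : ρ * a (k + 1) * a k ≤ a (k + 2) * a k := by nlinarith
      exact le_of_mul_le_mul_right h2 ih.1
  have hgeo : ∀ k, ρ ^ k * a 0 ≤ a k := by
    intro k
    induction k with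
    | zero => simp
    | succ k ih =>
      calc ρ ^ (k + 1) * a 0 = ρ * (ρ ^ k * a 0) := by ring
        _ ≤ ρ * a k := by gcongr
        _ ≤ a (k + 1) := (hind k).2
  obtain ⟨k, hk⟩ := pow_unbounded_of_one_lt (d / a 0) ((one_lt_div hc).2 hcρ)
  rw [div_pow, div_lt_div_iff₀ ha0pos (by positivity)] at hk
  exact absurd (hk.trans_le (hgeo k)) (not_lt.2 (hup k))

/-- Extreme states are multiplicative. -/
theorem map_mul_of_extreme (hM : IsQuadraticModule M) (hB : ∀ a : A, Bounded M a) {φ : A → ℝ}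
    (hφ : φ ∈ states M)
    (hext : ∀ φ₁ ∈ states M, ∀ φ₂ ∈ states M, φ ∈ openSegment ℝ φ₁ φ₂ → φ₁ = φ) (a b : A) :
    φ (a * b) = φ a * φ b := by
  have hzero : φ 0 = 0 := by simpa using hφ.2.1 0 0
  have hsq : ∀ f p, φ (f ^ 2 * p) = φ (f ^ 2) * φ p := by
    intro f p
    -- If `φ(f²) = 0`, the bounds `c ± p ∈ M` squeeze `φ(f² p)` to zero.
    rcases (hφ.2.2.2 _ (hM.sq_mem f)).eq_or_lt with h0 | hpos
    · obtain ⟨c, hc, h1, h2⟩ := hB p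
      have e1 := hφ.2.2.2 _ (hM.sq_mul_mem f h1)
      have e2 := hφ.2.2.2 _ (hM.sq_mul_mem f h2)
      rw [mul_sub, states_sub hφ, mul_comm, ← Algebra.smul_def, hφ.2.1, ← h0] at e1
      rw [mul_add, hφ.1, mul_comm, ← Algebra.smul_def, hφ.2.1, ← h0] at e2
      rw [← h0]; linarith
    · obtain ⟨c, hc, h1, -⟩ := hB (f ^ 2)
      -- Only `φ(f²) ≤ c` is available; doubling `c` makes it strict, so that both weights of the
      -- convex combination below are positive.
      have hlt : φ (f ^ 2) < 2 * c := by
        have e1 := hφ.2.2.2 _ h1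
        rw [states_sub hφ, states_algebraMap hφ] at e1
        linarith
      have h1' : algebraMap ℝ A (2 * c) - f ^ 2 ∈ M := by
        convert hM.add_mem h1 (hM.algebraMap_mem hc.le) using 1
        rw [map_mul, map_ofNat]; ring
      set s := φ (f ^ 2) with hs
      have hd : 0 < 2 * c - s := by linarith
      -- With `s = φ(f²)`, `φ` is the combination, with weights `s/(2c)` and `1 - s/(2c)`, of the
      -- normalisations of `q ↦ φ(f² q)` and `q ↦ φ((2c - f²) q)`. Extremality forces the first to
      -- equal `φ`.
      have m1 : (fun q => s⁻¹ * φ (f ^ 2 * q)) ∈ states M := by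
        refine ⟨fun x y => ?_, fun r x => ?_, ?_, fun q hq => ?_⟩
        · simp only [mul_add, hφ.1]
        · simp only [mul_smul_comm, hφ.2.1]; ring
        · simp only [mul_one, ← hs]; exact inv_mul_cancel₀ hpos.ne'
        · exact mul_nonneg (by positivity) (hφ.2.2.2 _ (hM.sq_mul_mem f hq))
      have m2 : (fun q => (2 * c - s)⁻¹ * (2 * c * φ q - φ (f ^ 2 * q))) ∈ states M := by
        refine ⟨fun x y => ?_, fun r x => ?_, ?_, fun q hq => ?_⟩
        · simp only [mul_add, hφ.1]; ring
        · simp only [mul_smul_comm, hφ.2.1]; ring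
        · simp only [mul_one, ← hs, hφ.2.2.1]; exact inv_mul_cancel₀ hd.ne'
        · refine mul_nonneg (by positivity) ?_
          have := state_sq_mul_le hM hφ (c := 2 * c) (by positivity) h1' hq (hB q)
          linarith
      have h := hext _ m1 _ m2 ⟨s / (2 * c), (2 * c - s) / (2 * c), by positivity, by positivity,
        by field_simp; ring, by
          funext q
          simp only [Pi.add_apply, Pi.smul_apply, smul_eq_mul]
          field_simp
          ring⟩
      have h' := congrFun h p
      rw [← h']
      field_simp
  -- Squares suffice, since `4a = (a + 1)² - (a - 1)²`.
  have e : φ (a * b) = 1 / 4 * φ ((a + 1) ^ 2 * b) - 1 / 4 * φ ((a - 1) ^ 2 * b) := by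
    rw [← mul_sub, ← states_sub hφ, ← hφ.2.1, ← sub_mul,
      show (a + 1) ^ 2 - (a - 1) ^ 2 = (4 : ℝ) • a by
        simp only [Algebra.smul_def, map_ofNat]; ring, smul_mul_assoc, smul_smul]
    norm_num
  have e' : φ a = 1 / 4 * φ ((a + 1) ^ 2) - 1 / 4 * φ ((a - 1) ^ 2) := by
    rw [← mul_sub, ← states_sub hφ, ← hφ.2.1,
      show (a + 1) ^ 2 - (a - 1) ^ 2 = (4 : ℝ) • a by
        simp only [Algebra.smul_def, map_ofNat]; ring, smul_smul]
    norm_num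
  rw [e, hsq, hsq, e']; ring

/-- If an element is not in an Archimedean quadratic module, some state is nonpositive on it. -/
theorem exists_state_nonpos (hM : IsQuadraticModule M) (hB : ∀ a : A, Bounded M a) {f : A}
    (hf : f ∉ M) : ∃ φ ∈ states M, φ f ≤ 0 := by
  -- Otherwise `f = (c + f) + c(-1)` would lie in `M`.
  have hneg : (-1 : A) ∉ M := by
    intro h
    obtain ⟨c, hc, -, h2⟩ := hB f
    refine hf ?_
    convert hM.add_mem h2 (hM.smul_mem hc.le h) using 1
    rw [Algebra.smul_def]; ring
  -- On the cone `M - ℝ≥0 f`, a nonnegative functional with value 1 at 1 is a state that is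
  -- nonpositive at `f`. It is extended from the line `ℝ · 1`.
  let C : PointedCone ℝ A :=
    { carrier := {x | ∃ p ∈ M, ∃ r : ℝ, 0 ≤ r ∧ x = p - r • f}
      add_mem' := by
        rintro _ _ ⟨p, hp, r, hr, rfl⟩ ⟨q, hq, s, hs, rfl⟩
        exact ⟨p + q, hM.add_mem hp hq, r + s, by positivity, by rw [add_smul]; abel⟩
      zero_mem' := ⟨0, hM.zero_mem, 0, le_rfl, by simp⟩
      smul_mem' := by
        rintro ⟨c, hc⟩ _ ⟨p, hp, r, hr, rfl⟩
        refine ⟨c • p, hM.smul_mem hc hp, c * r, by positivity, ?_⟩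
        change c • (p - r • f) = _
        rw [smul_sub, smul_smul] }
  have hMC : ∀ p ∈ M, p ∈ C := fun p hp => ⟨p, hp, 0, le_rfl, by simp⟩
  have hnC : (-1 : A) ∉ C := by
    rintro ⟨p, hp, r, hr, h⟩
    rcases hr.eq_or_lt with rfl | hr
    · apply hneg; rw [h]; simpa using hp
    · refine hf ?_
      have e : f = r⁻¹ • (p + 1) := by
        have : p + 1 = r • f := by linear_combination -h
        rw [this, smul_smul, inv_mul_cancel₀ hr.ne', one_smul]
      rw [e]
      exact hM.smul_mem (by positivity) (hM.add_mem hp hM.one_mem)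
  have hone : (1 : A) ≠ 0 := by
    intro h
    apply hneg
    rw [h, neg_zero]; exact hM.zero_mem
  obtain ⟨φ, hφ1, hφC⟩ := riesz_extension C (LinearPMap.mkSpanSingleton (1 : A) (1 : ℝ) hone)
    (by
      rintro ⟨x, hx⟩ hxC
      obtain ⟨r, rfl⟩ := Submodule.mem_span_singleton.1 hx
      rw [LinearPMap.mkSpanSingleton'_apply, smul_eq_mul, mul_one]
      by_contra hr
      push Not at hr
      change r < 0 at hr
      apply hnC
      have := C.smul_mem (show 0 ≤ (-r)⁻¹ from inv_nonneg.2 (by linarith)) hxC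
      change (-r)⁻¹ • r • (1 : A) ∈ C at this
      rw [smul_smul, inv_neg, neg_mul, inv_mul_cancel₀ hr.ne, neg_smul, one_smul] at this
      exact this)
    -- Boundedness says that 1 is an order unit, which is the cofinality condition of the Riesz
    -- extension theorem.
    (by
      intro y
      obtain ⟨c, hc, -, h2⟩ := hB y
      refine ⟨⟨c • (1 : A), Submodule.mem_span_singleton.2 ⟨c, rfl⟩⟩, ?_⟩
      rw [Algebra.algebraMap_eq_smul_one] at h2
      exact hMC _ h2)
  refine ⟨φ, ⟨map_add φ, fun r a => by simp, ?_, fun p hp => hφC p (hMC p hp)⟩, ?_⟩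
  · exact (hφ1 ⟨1, Submodule.mem_span_singleton_self 1⟩).trans
      (LinearPMap.mkSpanSingleton_apply ℝ ℝ hone 1)
  · have : 0 ≤ φ (-f) := hφC _ ⟨0, hM.zero_mem, 1, zero_le_one, by simp⟩
    rw [map_neg] at this; linarith

/-- The representation theorem for Archimedean quadratic modules. -/
theorem mem_of_forall_hom_pos (hM : IsQuadraticModule M) (hB : ∀ a : A, Bounded M a) {f : A}
    (hf : ∀ φ : A →ₐ[ℝ] ℝ, (∀ p ∈ M, 0 ≤ φ p) → 0 < φ f) : f ∈ M := by
  by_contra hfM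
  obtain ⟨φ₀, hφ₀, hle⟩ := exists_state_nonpos hM hB hfM
  obtain ⟨φ₁, hφ₁, hmin⟩ := (isCompact_states hB).exists_isMinOn ⟨φ₀, hφ₀⟩
    (f := fun φ : A → ℝ => φ f) (by fun_prop)
  rw [isMinOn_iff] at hmin
  -- The minimisers of `φ ↦ φ f` form a compact face, which has an extreme point by Krein–Milman.
  -- That point is extreme among all states: if an open segment of states contains a minimiser, both
  -- its ends are minimisers.
  have hS : IsCompact (states M ∩ {φ : A → ℝ | φ f = φ₁ f}) :=
    (isCompact_states hB).inter_right (isClosed_eq (by fun_prop) (by fun_prop))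
  obtain ⟨φ, ⟨hφ, hφf⟩, hext⟩ := hS.extremePoints_nonempty ⟨φ₁, hφ₁, rfl⟩
  have hmul := map_mul_of_extreme hM hB hφ fun ψ₁ h₁ ψ₂ h₂ hseg => by
    have hseg' := hseg
    obtain ⟨a, b, ha, hb, hab, e⟩ := hseg
    have ef : a * ψ₁ f + b * ψ₂ f = φ f := by rw [← e]; simp
    have g1 := hmin ψ₁ h₁
    have g2 := hmin ψ₂ h₂
    have hφf' : φ f = φ₁ f := hφf
    have t1 : a * φ₁ f + b * φ₁ f = φ₁ f := by rw [← add_mul, hab, one_mul]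
    have t2 : a * (ψ₁ f - φ₁ f) + b * (ψ₂ f - φ₁ f) = 0 := by linarith
    have t3 : 0 ≤ a * (ψ₁ f - φ₁ f) := mul_nonneg ha.le (by linarith)
    have t4 : 0 ≤ b * (ψ₂ f - φ₁ f) := mul_nonneg hb.le (by linarith)
    have t5 : a * (ψ₁ f - φ₁ f) = 0 := by linarith
    have t6 : b * (ψ₂ f - φ₁ f) = 0 := by linarith
    refine hext ⟨h₁, ?_⟩ ⟨h₂, ?_⟩ hseg'
    · have := (mul_eq_zero.1 t5).resolve_left ha.ne'
      change ψ₁ f = φ₁ f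
      linarith
    · have := (mul_eq_zero.1 t6).resolve_left hb.ne'
      change ψ₂ f = φ₁ f
      linarith
  let Φ : A →ₐ[ℝ] ℝ :=
    { toFun := φ
      map_one' := hφ.2.2.1
      map_mul' := hmul
      map_zero' := by simpa using hφ.2.1 0 0
      map_add' := hφ.1
      commutes' := fun r => states_algebraMap hφ r }
  have h1 : 0 < φ f := hf Φ hφ.2.2.2
  have h2 : φ f = φ₁ f := hφf
  have h3 := hmin φ₀ hφ₀
  linarith

end IsQuadraticModule
/-! ### Putinar's Positivstellensatz -/

section Putinar

variable {V I J : Type*} [Fintype I] [Fintype J] {g : I → MvPolynomial V ℝ}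
  {h : J → MvPolynomial V ℝ}

/-- The weighted sums of squares without degree restriction. -/
def wsosModule (g : I → MvPolynomial V ℝ) (h : J → MvPolynomial V ℝ) : Set (MvPolynomial V ℝ) :=
  {p | ∃ (s₀ : MvPolynomial V ℝ) (s : I → MvPolynomial V ℝ) (f : J → MvPolynomial V ℝ),
    IsSumSq s₀ ∧ (∀ a, IsSumSq (s a)) ∧ p = s₀ + ∑ a, s a * g a + ∑ b, f b * h b}

theorem isQuadraticModule_wsosModule (g : I → MvPolynomial V ℝ) (h : J → MvPolynomial V ℝ) :
    IsQuadraticModule (wsosModule g h) where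
  one_mem := ⟨1, 0, 0, .one, fun _ => .zero, by simp⟩
  add_mem := by
    rintro _ _ ⟨s₀, s, f, h₀, hs, rfl⟩ ⟨t₀, t, e, k₀, ht, rfl⟩
    refine ⟨s₀ + t₀, s + t, f + e, h₀.add k₀, fun a => (hs a).add (ht a), ?_⟩
    simp only [Pi.add_apply, add_mul, Finset.sum_add_distrib]
    ring
  sq_mul_mem := by
    rintro a _ ⟨s₀, s, f, h₀, hs, rfl⟩
    have ha : IsSumSq (a ^ 2) := by rw [sq]; exact .mul_self a
    refine ⟨a ^ 2 * s₀, fun i => a ^ 2 * s i, fun b => a ^ 2 * f b, ha.mul h₀,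
      fun i => ha.mul (hs i), ?_⟩
    simp only [mul_assoc, mul_add, Finset.mul_sum]

theorem ineq_mem_wsosModule (a : I) : g a ∈ wsosModule g h := by
  classical
  refine ⟨0, Pi.single a 1, 0, .zero, fun b => ?_, ?_⟩
  · rcases eq_or_ne b a with rfl | hb
    · simp
    · simp [hb]
  · simp [Pi.single_apply]

theorem mul_eq_mem_wsosModule (b : J) (f : MvPolynomial V ℝ) : f * h b ∈ wsosModule g h := by
  classical
  refine ⟨0, 0, Pi.single b f, .zero, fun _ => .zero, ?_⟩
  simp [Pi.single_apply]

theorem IsSumSq.eval_nonneg {p : MvPolynomial V ℝ} (hp : IsSumSq p) (z : V → ℝ) :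
    0 ≤ MvPolynomial.eval z p := by
  induction hp with
  | zero => simp
  | sq_add a _ ih =>
    rw [map_add, map_mul]
    exact add_nonneg (mul_self_nonneg _) ih

theorem WSOS.eval_nonneg {k : ℕ} {p : MvPolynomial V ℝ} (hp : p ∈ WSOS g h k) {z : V → ℝ}
    (hg : ∀ a, 0 ≤ MvPolynomial.eval z (g a)) (hh : ∀ b, MvPolynomial.eval z (h b) = 0) :
    0 ≤ MvPolynomial.eval z p := by
  obtain ⟨s₀, s, f, h₀, -, hs, -, rfl⟩ := hp
  simp only [map_add, map_sum, map_mul, hh, mul_zero, Finset.sum_const_zero, add_zero]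
  exact add_nonneg (IsSumSq.eval_nonneg h₀ z)
    (Finset.sum_nonneg fun a _ => mul_nonneg (IsSumSq.eval_nonneg (hs a).1 z) (hg a))

theorem zero_mem_WSOS (k : ℕ) : (0 : MvPolynomial V ℝ) ∈ WSOS g h k :=
  ⟨0, 0, 0, .zero, by simp, fun _ => ⟨.zero, by simp⟩, fun _ => by simp, by simp⟩

theorem eventually_mem_WSOS {p : MvPolynomial V ℝ} (hp : p ∈ wsosModule g h) :
    ∀ᶠ k in atTop, p ∈ WSOS g h k := by
  obtain ⟨s₀, s, f, h₀, hs, rfl⟩ := hp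
  filter_upwards [eventually_ge_atTop s₀.totalDegree,
    eventually_all.2 fun a => eventually_ge_atTop (s a * g a).totalDegree,
    eventually_all.2 fun b => eventually_ge_atTop (f b * h b).totalDegree] with k k₀ k₁ k₂
  exact ⟨s₀, s, f, h₀, by omega, fun a => ⟨hs a, by have := k₁ a; omega⟩,
    fun b => by have := k₂ b; omega, rfl⟩

/-- **Putinar's Positivstellensatz.** -/
theorem putinar (hX : ∀ v, IsQuadraticModule.Bounded (wsosModule g h) (MvPolynomial.X v))
    {p : MvPolynomial V ℝ}
    (hp : ∀ z : V → ℝ, (∀ a, 0 ≤ MvPolynomial.eval z (g a)) →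
      (∀ b, MvPolynomial.eval z (h b) = 0) → 0 < MvPolynomial.eval z p) :
    ∀ᶠ k in atTop, p ∈ WSOS g h k := by
  have hM := isQuadraticModule_wsosModule g h
  refine eventually_mem_WSOS (hM.mem_of_forall_hom_pos (fun a => ?_) fun φ hφ => ?_)
  · induction a using MvPolynomial.induction_on with
    | C r => exact hM.bounded_algebraMap r
    | add p q hp hq => exact hp.add hM hq
    | mul_X p v hp => exact hp.mul hM (hX v)
  -- A homomorphism from polynomials to `ℝ` is evaluation at the images of the variables.
  · have e : ∀ q, φ q = MvPolynomial.eval (fun v => φ (MvPolynomial.X v)) q := by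
      intro q
      have h1 : φ = MvPolynomial.aeval (fun v => φ (MvPolynomial.X v)) :=
        MvPolynomial.algHom_ext fun v => by simp
      conv_lhs => rw [h1]
      exact RingHom.congr_fun (MvPolynomial.coe_aeval_eq_eval _) q
    rw [e]
    refine hp _ (fun a => ?_) fun b => ?_
    · rw [← e]; exact hφ _ (ineq_mem_wsosModule a)
    · rw [← e]
      -- The module contains both `h b` and `-h b`, so the point satisfies the equation.
      have h1 := hφ _ (mul_eq_mem_wsosModule b 1)
      have h2 := hφ _ (mul_eq_mem_wsosModule b (-1))
      rw [one_mul] at h1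
      rw [neg_one_mul, map_neg] at h2
      linarith

end Putinar

/-! ### The descriptions of the support sets -/

section Descriptions

variable {m : ℕ} {R : ℝ}

theorem IsQuadraticModule.sum_sq_mem {A ι : Type*} [CommRing A] [Algebra ℝ A] {M : Set A}
    (hM : IsQuadraticModule M) (s : Finset ι) (a : ι → A) : ∑ i ∈ s, a i ^ 2 ∈ M := by
  classical
  induction s using Finset.induction_on with
  | empty => simpa using hM.zero_mem
  | insert i s hi ih => rw [Finset.sum_insert hi]; exact hM.add_mem (hM.sq_mem _) ih

theorem IsQuadraticModule.bounded_of_sum_sq {A ι : Type*} [CommRing A] [Algebra ℝ A] [Fintype ι]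
    {M : Set A} (hM : IsQuadraticModule M) {c : ℝ} {a : ι → A}
    (h : algebraMap ℝ A c - ∑ i, a i ^ 2 ∈ M) (i : ι) : Bounded M (a i) := by
  classical
  refine hM.bounded_of_sq (c := c) ?_
  convert hM.add_mem h (hM.sum_sq_mem (Finset.univ.erase i) a) using 1
  rw [← Finset.add_sum_erase _ _ (Finset.mem_univ i)]; ring

theorem orthEq_eq (e : Fin (m + 1) × Fin (m + 1)) :
    orthEq m e = ∑ i, frameMatrix MvPolynomial.X i e.1 * frameMatrix MvPolynomial.X i e.2 -
      (1 : Matrix (Fin (m + 1)) (Fin (m + 1)) (MvPolynomial (FrameVar m) ℝ)) e.1 e.2 := by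
  simp [orthEq, Matrix.mul_apply]

theorem eval_orthEq (q : FrameVar m → ℝ) (e : Fin (m + 1) × Fin (m + 1)) :
    MvPolynomial.eval q (orthEq m e) =
      ((frameMatrix q)ᵀ * frameMatrix q) e.1 e.2 - (1 : Matrix _ _ ℝ) e.1 e.2 := by
  have h : ∀ i j, MvPolynomial.eval q (frameMatrix MvPolynomial.X i j) = frameMatrix q i j := by
    intro i j
    refine Fin.cases ?_ (fun j => ?_) j <;> simp [frameMatrix]
  rw [orthEq_eq]
  simp only [map_sub, map_sum, map_mul, h, Matrix.mul_apply, Matrix.transpose_apply]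
  by_cases h : e.1 = e.2 <;> simp [Matrix.one_apply, h]

theorem mem_OmegaZ_iff (q : FrameVar m → ℝ) (hR : 0 ≤ R) :
    q ∈ OmegaZ m R ↔ 0 ≤ MvPolynomial.eval q (offsetIneq m R) ∧
      ∀ e, MvPolynomial.eval q (orthEq m e) = 0 := by
  have h1 : q offsetVar ∈ Icc (-R) R ↔ 0 ≤ MvPolynomial.eval q (offsetIneq m R) := by
    simp only [offsetIneq, map_sub, map_pow, MvPolynomial.eval_C, MvPolynomial.eval_X, sub_nonneg,
      mem_Icc]
    rw [sq_le_sq, abs_of_nonneg hR, abs_le]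
  have h2 : frameMatrix q ∈ Matrix.orthogonalGroup (Fin (m + 1)) ℝ ↔
      ∀ e, MvPolynomial.eval q (orthEq m e) = 0 := by
    rw [Matrix.mem_orthogonalGroup_iff']
    simp only [eval_orthEq, sub_eq_zero]
    constructor
    · intro h e
      rw [← h]
    · intro h
      ext i j
      exact h (i, j)
  rw [← h1, ← h2]
  simp only [OmegaZ, mem_ofPred_eq]
  refine ⟨fun h => h.2, fun h => ⟨?_, h⟩⟩
  -- The condition `‖θ‖ = 1` is the `(0, 0)` entry of the orthogonality equations.
  have := (h2.1 h.2) (0, 0)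
  rw [eval_orthEq, sub_eq_zero] at this
  simpa [Matrix.mul_apply, frameMatrix, sq] using this

/-- The diagonal equations make the columns of `[θ, Z]` unit vectors, and `R² - t²` bounds `t`. The
map `ι` lets one proof serve polynomials in `(θ, t, Z)` and in `(θ, t, Z, y)`. -/
theorem bounded_frameVar {B : Type*} [CommRing B] [Algebra ℝ B] {M : Set B}
    (hM : IsQuadraticModule M) (ι : MvPolynomial (FrameVar m) ℝ →ₐ[ℝ] B)
    (h₁ : ι (offsetIneq m R) ∈ M) (h₂ : ∀ e, -ι (orthEq m e) ∈ M) (v : FrameVar m) :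
    IsQuadraticModule.Bounded M (ι (MvPolynomial.X v)) := by
  have hcol : ∀ i j : Fin (m + 1),
      IsQuadraticModule.Bounded M (ι (frameMatrix MvPolynomial.X i j)) := by
    intro i j
    refine hM.bounded_of_sum_sq (c := 1) (a := fun i => ι (frameMatrix MvPolynomial.X i j)) ?_ i
    convert h₂ (j, j) using 1
    rw [orthEq_eq]
    simp only [Matrix.one_apply_eq, map_sub, map_sum, map_mul, map_one, sq]
    ring
  rcases v with (i | ⟨⟩) | ⟨i, j⟩
  · simpa [frameMatrix, thetaVar] using hcol i 0
  · refine hM.bounded_of_sq (c := R ^ 2) ?_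
    convert h₁ using 1
    rw [offsetIneq, map_sub, ← MvPolynomial.algebraMap_eq, AlgHom.commutes, map_pow ι]
    rfl
  · simpa [frameMatrix, frameVar] using hcol i j.succ

theorem eval_lift (p : MvPolynomial (FrameVar m) ℝ) (z : SliceVar m → ℝ) :
    MvPolynomial.eval z (lift p) = MvPolynomial.eval (framePart z) p := by
  rw [lift, MvPolynomial.eval_rename]; rfl

theorem eval_pull (p : MvPolynomial (Fin (m + 1)) ℝ) (z : SliceVar m → ℝ) :
    MvPolynomial.eval z (pull p) = MvPolynomial.eval (slicePoint z) p := by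
  rw [pull, MvPolynomial.eval, MvPolynomial.eval₂Hom_bind₁]
  congr 2
  funext i
  simp [slicePoint]

theorem mem_Psi_iff (z : SliceVar m → ℝ) (hR : 0 ≤ R) :
    z ∈ Psi m R ↔ (∀ a, 0 ≤ MvPolynomial.eval z (psiIneq m R a)) ∧
      ∀ e, MvPolynomial.eval z (lift (orthEq m e)) = 0 := by
  simp only [Psi, mem_ofPred_eq, mem_OmegaZ_iff _ hR, Fin.forall_fin_two, eval_lift, psiIneq,
    Matrix.cons_val_zero, Matrix.cons_val_one, ball]
  simp [coordPart, and_right_comm]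

theorem mem_PsiL_iff {N : ℕ} (g : Fin N → MvPolynomial (Fin (m + 1)) ℝ) (z : SliceVar m → ℝ)
    (hR : 0 ≤ R) :
    z ∈ PsiL R (basicSet g) ↔ (∀ a, 0 ≤ MvPolynomial.eval z (psiLIneq R g a)) ∧
      ∀ e, MvPolynomial.eval z (lift (orthEq m e)) = 0 := by
  simp only [PsiL, mem_ofPred_eq, mem_Psi_iff _ hR, psiLIneq, Sum.forall, Sum.elim_inl,
    Sum.elim_inr, basicSet, eval_pull, and_right_comm]

theorem bounded_sliceVar {I J : Type*} [Fintype I] [Fintype J] {g : I → MvPolynomial (SliceVar m) ℝ}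
    {h : J → MvPolynomial (SliceVar m) ℝ} (hg : ∀ a, psiIneq m R a ∈ wsosModule g h)
    (hh : ∀ e, -lift (orthEq m e) ∈ wsosModule g h) (v : SliceVar m) :
    IsQuadraticModule.Bounded (wsosModule g h) (MvPolynomial.X v) := by
  have hM := isQuadraticModule_wsosModule g h
  rcases v with v | j
  · have := bounded_frameVar hM (MvPolynomial.rename Sum.inl) (R := R) (hg 0) hh v
    simpa using this
  · exact hM.bounded_of_sum_sq (c := R ^ 2) (a := fun j => MvPolynomial.X (coordVar j)) (hg 1) j

theorem eventually_mem_sosOmegaZ (hR : 0 ≤ R) {p : MvPolynomial (FrameVar m) ℝ}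
    (hp : ∀ q ∈ OmegaZ m R, 0 < MvPolynomial.eval q p) : ∀ᶠ k in atTop, p ∈ sosOmegaZ m R k := by
  refine putinar (fun v => ?_) fun z h₁ h₂ => hp z ((mem_OmegaZ_iff z hR).2 ⟨h₁ (), h₂⟩)
  refine bounded_frameVar (R := R) (isQuadraticModule_wsosModule _ _) (AlgHom.id ℝ _)
    (ineq_mem_wsosModule (g := fun _ : Unit => offsetIneq m R) ()) (fun e => ?_) v
  simpa using mul_eq_mem_wsosModule (g := fun _ : Unit => offsetIneq m R) (h := orthEq m) e (-1)

theorem eventually_mem_sosPsi (hR : 0 ≤ R) {p : MvPolynomial (SliceVar m) ℝ}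
    (hp : ∀ z ∈ Psi m R, 0 < MvPolynomial.eval z p) : ∀ᶠ k in atTop, p ∈ sosPsi m R k := by
  refine putinar (fun v => ?_) fun z h₁ h₂ => hp z ((mem_Psi_iff z hR).2 ⟨h₁, h₂⟩)
  refine bounded_sliceVar (R := R) (fun a => ineq_mem_wsosModule a) (fun e => ?_) v
  simpa using mul_eq_mem_wsosModule (g := psiIneq m R) (h := fun e => lift (orthEq m e)) e (-1)

theorem eventually_mem_sosPsiL {N : ℕ} (hR : 0 ≤ R) {g : Fin N → MvPolynomial (Fin (m + 1)) ℝ}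
    {p : MvPolynomial (SliceVar m) ℝ}
    (hp : ∀ z ∈ PsiL R (basicSet g), 0 < MvPolynomial.eval z p) :
    ∀ᶠ k in atTop, p ∈ sosPsiL R g k := by
  refine putinar (fun v => ?_) fun z h₁ h₂ => hp z ((mem_PsiL_iff g z hR).2 ⟨h₁, h₂⟩)
  refine bounded_sliceVar (R := R)
    (fun a => ineq_mem_wsosModule (g := psiLIneq R g) (Sum.inl a)) (fun e => ?_) v
  simpa using mul_eq_mem_wsosModule (g := psiLIneq R g) (h := fun e => lift (orthEq m e)) e (-1)

end Descriptions

/-! ### Integration over the ball -/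

section Ball

variable {m : ℕ} {R : ℝ}

theorem abs_le_of_mem_ball {d : ℕ} {x : Fin d → ℝ} (hR : 0 ≤ R) (hx : x ∈ ball d R) (i : Fin d) :
    |x i| ≤ R := by
  refine abs_le_of_sq_le_sq (le_trans ?_ hx) hR
  exact Finset.single_le_sum (f := fun i => x i ^ 2) (fun i _ => sq_nonneg _) (Finset.mem_univ i)

theorem isCompact_ball (d : ℕ) (hR : 0 ≤ R) : IsCompact (ball d R) := by
  refine IsCompact.of_isClosed_subset (isCompact_univ_pi fun _ => isCompact_Icc (a := -R) (b := R))
    (isClosed_le (by fun_prop) (by fun_prop)) fun x hx i _ => ?_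
  exact abs_le.1 (abs_le_of_mem_ball hR hx i)

theorem isClosed_OmegaZ (hR : 0 ≤ R) : IsClosed (OmegaZ m R) := by
  have e : OmegaZ m R = {q | 0 ≤ MvPolynomial.eval q (offsetIneq m R)} ∩
      ⋂ e, {q | MvPolynomial.eval q (orthEq m e) = 0} := by
    ext q; simp [mem_OmegaZ_iff q hR]
  rw [e]
  exact (isClosed_le continuous_const (MvPolynomial.continuous_eval _)).inter
    (isClosed_iInter fun e => isClosed_eq (MvPolynomial.continuous_eval _) continuous_const)

theorem isCompact_OmegaZ (hR : 0 ≤ R) : IsCompact (OmegaZ m R) := by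
  refine IsCompact.of_isClosed_subset
    (isCompact_univ_pi fun _ => isCompact_Icc (a := -(max 1 R)) (b := max 1 R))
    (isClosed_OmegaZ hR) fun q hq v _ => ?_
  have hent : ∀ i j, |frameMatrix q i j| ≤ 1 := fun i j => entry_norm_bound_of_unitary hq.2.2 i j
  refine abs_le.1 ?_
  rcases v with (i | ⟨⟩) | ⟨i, j⟩
  · exact (hent i 0).trans (le_max_left _ _)
  · exact (abs_le.2 hq.2.1).trans (le_max_right _ _)
  · exact (hent i j.succ).trans (le_max_left _ _)

theorem continuous_joinPoint :
    Continuous fun p : (FrameVar m → ℝ) × (Fin m → ℝ) => joinPoint p.1 p.2 := by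
  refine continuous_pi fun v => ?_
  rcases v with v | j
  · exact (continuous_apply v).comp continuous_fst
  · exact (continuous_apply j).comp continuous_snd

theorem joinPoint_framePart_coordPart (z : SliceVar m → ℝ) :
    joinPoint (framePart z) (coordPart z) = z := by
  funext v; rcases v with v | j <;> rfl

theorem joinPoint_mem_Psi {q : FrameVar m → ℝ} {y : Fin m → ℝ} (hq : q ∈ OmegaZ m R)
    (hy : y ∈ ball m R) : joinPoint q y ∈ Psi m R := ⟨hq, hy⟩

theorem isCompact_Psi (hR : 0 ≤ R) : IsCompact (Psi m R) := by
  convert ((isCompact_OmegaZ hR).prod (isCompact_ball m hR)).image continuous_joinPoint using 1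
  ext z
  constructor
  · intro hz
    exact ⟨(framePart z, coordPart z), hz, joinPoint_framePart_coordPart z⟩
  · rintro ⟨⟨q, y⟩, ⟨hq, hy⟩, rfl⟩
    exact joinPoint_mem_Psi hq hy

theorem isCompact_PsiL {N : ℕ} (g : Fin N → MvPolynomial (Fin (m + 1)) ℝ) (hR : 0 ≤ R) :
    IsCompact (PsiL R (basicSet g)) := by
  have e : PsiL R (basicSet g) = Psi m R ∩ ⋂ i, {z | 0 ≤ MvPolynomial.eval z (pull (g i))} := by
    ext z; simp [PsiL, basicSet, eval_pull]
  rw [e]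
  exact (isCompact_Psi hR).inter_right (isClosed_iInter fun i =>
    isClosed_le continuous_const (MvPolynomial.continuous_eval _))

theorem integrableOn_slice (hR : 0 ≤ R) {w : (SliceVar m → ℝ) → ℝ} (hw : ContinuousOn w (Psi m R))
    {q : FrameVar m → ℝ} (hq : q ∈ OmegaZ m R) :
    IntegrableOn (fun y => w (joinPoint q y)) (ball m R) := by
  refine ContinuousOn.integrableOn_compact (isCompact_ball m hR) ?_
  exact hw.comp (continuous_joinPoint.comp (by fun_prop : Continuous fun y => (q, y))).continuousOn
    fun y hy => joinPoint_mem_Psi hq hy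

theorem integrableOn_eval_slice (hR : 0 ≤ R) (w : MvPolynomial (SliceVar m) ℝ)
    (q : FrameVar m → ℝ) :
    IntegrableOn (fun y => MvPolynomial.eval (joinPoint q y) w) (ball m R) := by
  refine ContinuousOn.integrableOn_compact (isCompact_ball m hR) (Continuous.continuousOn ?_)
  exact (MvPolynomial.continuous_eval w).comp
    (continuous_joinPoint.comp (by fun_prop : Continuous fun y => (q, y)))

/-- Integrating out `y` takes polynomials to polynomials. -/
theorem exists_polynomial_Lam (hR : 0 ≤ R) (w : MvPolynomial (SliceVar m) ℝ) :
    ∃ Q : MvPolynomial (FrameVar m) ℝ, ∀ x,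
      MvPolynomial.eval x Q = Lam R (fun z => MvPolynomial.eval z w) x := by
  induction w using MvPolynomial.induction_on' with
  | monomial d r =>
    refine ⟨MvPolynomial.C (r * ∫ y in ball m R, ∏ j, y j ^ d (Sum.inr j)) *
      ∏ v, MvPolynomial.X v ^ d (Sum.inl v), fun x => ?_⟩
    have e : ∀ y, MvPolynomial.eval (joinPoint x y) (MvPolynomial.monomial d r) =
        (r * ∏ v, x v ^ d (Sum.inl v)) * ∏ j, y j ^ d (Sum.inr j) := by
      intro y
      rw [MvPolynomial.eval_monomial, Finsupp.prod_fintype _ _ (by simp), Fintype.prod_sum_type]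
      simp [joinPoint, mul_assoc]
    simp only [Lam, e, integral_const_mul, map_mul, map_prod, map_pow, MvPolynomial.eval_C,
      MvPolynomial.eval_X]
    ring
  | add p q hp hq =>
    obtain ⟨P, hP⟩ := hp
    obtain ⟨Q, hQ⟩ := hq
    refine ⟨P + Q, fun x => ?_⟩
    rw [map_add, hP, hQ]
    simp only [Lam, map_add]
    rw [integral_add (integrableOn_eval_slice hR p x) (integrableOn_eval_slice hR q x)]

end Ball

/-! ### Approximation by polynomials and the upper bound -/

section Upper

/-- Polynomials are dense in the continuous functions on a compact set. -/
theorem exists_polynomial_near {V : Type*} {K : Set (V → ℝ)} (hK : IsCompact K) {f : (V → ℝ) → ℝ}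
    (hf : ContinuousOn f K) {ε : ℝ} (hε : 0 < ε) :
    ∃ p : MvPolynomial V ℝ, ∀ z ∈ K, |MvPolynomial.eval z p - f z| < ε := by
  have : CompactSpace K := isCompact_iff_compactSpace.1 hK
  let X : V → C(K, ℝ) := fun v => ⟨fun z => (z : V → ℝ) v,
    (continuous_apply v).comp continuous_subtype_val⟩
  have hX : ∀ (p : MvPolynomial V ℝ) (z : K),
      MvPolynomial.aeval X p z = MvPolynomial.eval (z : V → ℝ) p := by
    intro p z
    induction p using MvPolynomial.induction_on with
    | C r => simp
    | add p q hp hq => simp [hp, hq]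
    | mul_X p v hp => simp [hp, X]
  -- Stone–Weierstrass for the algebra generated by the coordinate functions.
  let S : Subalgebra ℝ C(K, ℝ) := (MvPolynomial.aeval X).range
  have hS : S.SeparatesPoints := by
    intro x y hxy
    obtain ⟨v, hv⟩ := Function.ne_iff.1 (Subtype.coe_injective.ne hxy)
    exact ⟨_, ⟨X v, ⟨MvPolynomial.X v, by simp⟩, rfl⟩, hv⟩
  obtain ⟨⟨_, ⟨p, rfl⟩⟩, hp⟩ :=
    ContinuousMap.exists_mem_subalgebra_near_continuous_of_separatesPoints S hS (fun z : K => f z) (continuousOn_iff_continuous_domRestrict.1 hf) ε hε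
  refine ⟨p, fun z hz => ?_⟩
  have := hp ⟨z, hz⟩
  rw [Real.norm_eq_abs] at this
  exact (hX p ⟨z, hz⟩) ▸ this

/-- The slack `c - γ` pays for approximating `w + ε` by a polynomial: positivity on each support set
becomes strict, as Putinar's theorem requires. -/
theorem eventually_pStarStokesSOS_le {m N : ℕ} {R : ℝ} (hR : 0 ≤ R)
    (g : Fin N → MvPolynomial (Fin (m + 1)) ℝ) {γ c : ℝ} {w : (SliceVar m → ℝ) → ℝ}
    (hw : Feasible R (basicSet g) γ w) (hc : γ < c) :
    ∀ᶠ k in atTop, pStarStokesSOS R g k ≤ c := by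
  set V := volume.real (ball m R) with hV
  have hV0 : 0 ≤ V := measureReal_nonneg
  -- Since `p ≤ w + 2ε`, the integral grows by at most `2εV < c - γ`; the `+ 1` covers `V = 0`.
  set ε := (c - γ) / (2 * (V + 1)) with hε
  have hεpos : 0 < ε := div_pos (by linarith) (by positivity)
  obtain ⟨p, hp⟩ := exists_polynomial_near (isCompact_Psi hR)
    (hw.continuousOn.add continuousOn_const (g := fun _ => ε)) hεpos
  have hlow : ∀ z ∈ Psi m R, w z < MvPolynomial.eval z p := fun z hz => by
    have := (abs_lt.1 (hp z hz)).1
    simp only [Pi.add_apply] at this; linarith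
  have hupp : ∀ z ∈ Psi m R, MvPolynomial.eval z p ≤ w z + 2 * ε := fun z hz => by
    have := (abs_lt.1 (hp z hz)).2
    simp only [Pi.add_apply] at this; linarith
  obtain ⟨Q, hQ⟩ := exists_polynomial_Lam hR p
  have hLam : ∀ q ∈ OmegaZ m R, MvPolynomial.eval q Q < c := by
    intro q hq
    rw [hQ]
    have hfin : volume (ball m R) ≠ ⊤ := (isCompact_ball m hR).measure_lt_top.ne
    have hw_int := integrableOn_slice hR hw.continuousOn hq
    calc Lam R (fun z => MvPolynomial.eval z p) q
        ≤ ∫ y in ball m R, (w (joinPoint q y) + 2 * ε) := by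
          refine setIntegral_mono_on (integrableOn_eval_slice hR p q)
            (hw_int.add (integrableOn_const hfin))
            (isCompact_ball m hR).measurableSet fun y hy => hupp _ (joinPoint_mem_Psi hq hy)
      _ = Lam R w q + V * (2 * ε) := by
          rw [integral_add hw_int (integrableOn_const hfin), setIntegral_const, smul_eq_mul]; rfl
      _ ≤ γ + V * (2 * ε) := by gcongr; exact hw.integral_le q hq
      _ < γ + (V + 1) * (2 * ε) := by linarith
      _ = c := by rw [hε]; field_simp; ring
  have e1 := eventually_mem_sosOmegaZ hR (p := MvPolynomial.C c - Q) fun q hq => by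
    have := hLam q hq
    simp only [map_sub, MvPolynomial.eval_C]; linarith
  have e2 := eventually_mem_sosPsiL hR (g := g) (p := p - 1) fun z hz => by
    have h1 := hlow z hz.1
    have h2 := hw.one_le z hz
    simp only [map_sub, map_one]; linarith
  have e3 := eventually_mem_sosPsi hR (p := p) fun z hz => (hw.nonneg z hz).trans_lt (hlow z hz)
  filter_upwards [e1, e2, e3, eventually_ge_atTop p.totalDegree] with k h1 h2 h3 h4
  -- With `u = 0` both Stokes terms vanish, and the degree condition on `u` holds through its zero
  -- alternative.
  refine sInf_le ⟨c, p, 0, ⟨⟨_, h1, fun x => by simp [hQ]⟩, ?_, fun i => ?_, h3, by omega,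
    fun j => Or.inl rfl⟩, rfl⟩
  · simpa [divY, symm] using h2
  · have : -symm (dotGradY 0 (g i)) = (0 : MvPolynomial (SliceVar m) ℝ) := by
      simp [dotGradY, symm]
    rw [this]
    exact zero_mem_WSOS k

end Upper

/-! ### The optimal value of the function program -/

section FunctionProgram

variable {m : ℕ} {R : ℝ}

theorem continuous_Lam (hR : 0 ≤ R) {w : (SliceVar m → ℝ) → ℝ} (hw : Continuous w) :
    Continuous (Lam R w) :=
  continuous_parametric_integral_of_continuous
    (f := fun q y => w (joinPoint q y)) (hw.comp continuous_joinPoint) (isCompact_ball m hR)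

/-- If all slices have volume at most `γ`, then `p* ≤ γ`. -/
theorem pStar_le {L : Set (Fin (m + 1) → ℝ)} (hR : 0 ≤ R) (hL : IsClosed (PsiL R L)) {γ : ℝ}
    (hγ : ∀ q ∈ OmegaZ m R, volume.real {y ∈ ball m R | slicePoint (joinPoint q y) ∈ L} ≤ γ) :
    pStar R L ≤ γ := by
  by_contra hcon
  obtain ⟨c, hγc, hc⟩ := EReal.lt_iff_exists_real_btwn.1 (not_le.1 hcon)
  rw [EReal.coe_lt_coe_iff] at hγc
  refine absurd hc (not_lt.2 ?_)
  have hδ : ∀ n : ℕ, (0 : ℝ) < 1 / ((n : ℝ) + 1) := fun n => by positivity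
  -- Continuous functions decreasing to the indicator of the closed set `Ψ_L`; their integrals over
  -- each slice decrease to the slice volume.
  let w : ℕ → (SliceVar m → ℝ) → ℝ := fun n z => thickenedIndicator (hδ n) (PsiL R L) z
  have hwc : ∀ n, Continuous (w n) := fun n =>
    NNReal.continuous_coe.comp (thickenedIndicator (hδ n) (PsiL R L)).continuous
  have hw1 : ∀ n z, w n z ≤ 1 := fun n z =>
    NNReal.coe_le_one.2 (thickenedIndicator_le_one (hδ n) (PsiL R L) z)
  have hw0 : ∀ n z, 0 ≤ w n z := fun n z => NNReal.coe_nonneg _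
  have hanti : ∀ n k, n ≤ k → ∀ z, w k z ≤ w n z := fun n k hnk z => by
    have := thickenedIndicator_mono (hδ k) (hδ n)
      (one_div_le_one_div_of_le (by positivity) (by exact_mod_cast Nat.succ_le_succ hnk))
      (PsiL R L) z
    exact NNReal.coe_le_coe.2 this
  have hlim : ∀ z, Tendsto (fun n => w n z) atTop
      (𝓝 ((PsiL R L).indicator (fun _ => (1 : ℝ)) z)) := by
    intro z
    have h := tendsto_pi_nhds.1 (thickenedIndicator_tendsto_indicator_closure hδ
      tendsto_one_div_add_atTop_nhds_zero_nat (PsiL R L)) z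
    rw [hL.closure_eq] at h
    have h2 := (NNReal.continuous_coe.tendsto _).comp h
    have e : (PsiL R L).indicator (fun _ => (1 : ℝ)) z =
        ((PsiL R L).indicator (fun _ => (1 : NNReal)) z : NNReal) := by
      by_cases hz : z ∈ PsiL R L <;> simp [hz]
    rw [e]
    exact h2
  have hLamlim : ∀ q ∈ OmegaZ m R, ∃ n, Lam R (w n) q < c := by
    intro q hq
    have h : Tendsto (fun n => Lam R (w n) q) atTop
        (𝓝 (∫ y in ball m R, (PsiL R L).indicator (fun _ => (1 : ℝ)) (joinPoint q y))) := by
      refine tendsto_integral_of_dominated_convergence (fun _ => 1) (fun n => ?_) ?_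
        (fun n => Eventually.of_forall fun y => ?_) (Eventually.of_forall fun y => hlim _)
      · exact ((hwc n).comp (continuous_joinPoint.comp
          (by fun_prop : Continuous fun y => (q, y)))).aestronglyMeasurable
      · exact integrableOn_const (isCompact_ball m hR).measure_lt_top.ne
      · rw [Real.norm_of_nonneg (hw0 _ _)]; exact hw1 _ _
    have hcl : MeasurableSet {y | joinPoint q y ∈ PsiL R L} :=
      (hL.preimage (continuous_joinPoint.comp
        (by fun_prop : Continuous fun y => (q, y)))).measurableSet
    have e : ∫ y in ball m R, (PsiL R L).indicator (fun _ => (1 : ℝ)) (joinPoint q y) =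
        volume.real {y ∈ ball m R | slicePoint (joinPoint q y) ∈ L} := by
      have e1 : (fun y => (PsiL R L).indicator (fun _ => (1 : ℝ)) (joinPoint q y)) =
          {y | joinPoint q y ∈ PsiL R L}.indicator fun _ => (1 : ℝ) := by
        funext y; rfl
      rw [e1, setIntegral_indicator hcl, setIntegral_const, smul_eq_mul, mul_one]
      congr 1
      ext y
      exact ⟨fun h => ⟨h.1, h.2.2⟩, fun h => ⟨h.1, joinPoint_mem_Psi hq h.1, h.2⟩⟩
    rw [e] at h
    exact (h.eventually (gt_mem_nhds ((hγ q hq).trans_lt hγc))).exists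
  -- Dini's argument: the open sets where the `n`-th integral is below `c` increase and cover the
  -- compact `Ω_Z`, so one `n` works for all frames.
  obtain ⟨n, hn⟩ := (isCompact_OmegaZ hR).elim_directed_cover
    (fun n => {q : FrameVar m → ℝ | Lam R (w n) q < c})
    (fun n => isOpen_lt (continuous_Lam hR (hwc n)) continuous_const)
    (fun q hq => mem_iUnion.2 (hLamlim q hq))
    (directed_of_isDirected_le fun n k hnk q (hq : Lam R (w n) q < c) => by
      refine lt_of_le_of_lt ?_ hq
      have hi : ∀ n, IntegrableOn (fun y => w n (joinPoint q y)) (ball m R) := fun n =>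
        ((hwc n).comp (continuous_joinPoint.comp
          (by fun_prop : Continuous fun y => (q, y)))).continuousOn.integrableOn_compact
          (isCompact_ball m hR)
      exact integral_mono (hi k) (hi n) fun y => hanti n k hnk _)
  refine sInf_le ⟨c, w n, ⟨fun q hq => (hn hq).le, fun z hz => ?_, fun z _ => hw0 n z,
    (hwc n).continuousOn⟩, rfl⟩
  exact NNReal.one_le_coe.2 (thickenedIndicator_one (hδ n) (PsiL R L) hz).ge

end FunctionProgram

/-! ### Zero sets of polynomials -/

theorem lintegral_insertNth {n : ℕ} (j : Fin (n + 1)) {f : (Fin (n + 1) → ℝ) → ENNReal}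
    (hf : Measurable f) :
    ∫⁻ x, f x = ∫⁻ y : Fin n → ℝ, ∫⁻ t : ℝ, f (j.insertNth t y) := by
  have hmp := (volume_preserving_piFinSuccAbove (fun _ : Fin (n + 1) => ℝ) j).symm
  rw [← hmp.lintegral_comp hf, Measure.volume_eq_prod,
    lintegral_prod_symm' (fun z => f ((MeasurableEquiv.piFinSuccAbove (fun _ => ℝ) j).symm z))
      (hf.comp hmp.measurable)]
  rfl

/-- The zero set of a nonzero polynomial is a null set. -/
theorem volume_zeros_eq_zero {n : ℕ} {p : MvPolynomial (Fin n) ℝ} (hp : p ≠ 0) :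
    volume {x | MvPolynomial.eval x p = 0} = 0 := by
  induction n with
  | zero =>
    obtain ⟨r, rfl⟩ := MvPolynomial.C_surjective (Fin 0) p
    have : r ≠ 0 := by rintro rfl; simp at hp
    simp [this]
  | succ n ih =>
    set P := MvPolynomial.finSuccEquiv ℝ n p with hP
    have hP0 : P ≠ 0 := by simpa [hP] using hp
    have hlead := ih (Polynomial.leadingCoeff_ne_zero.2 hP0)
    have hmeas : MeasurableSet {x | MvPolynomial.eval x p = 0} :=
      (isClosed_eq (MvPolynomial.continuous_eval p) continuous_const).measurableSet
    rw [← lintegral_indicator_one hmeas,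
      lintegral_insertNth 0 (measurable_one.indicator hmeas)]
    refine lintegral_eq_zero_of_ae_eq_zero ?_
    -- By Fubini it suffices to look at lines in direction 0: off the zero set of the leading
    -- coefficient, which is null by induction, the restriction is a nonzero polynomial with
    -- finitely many roots.
    have hae : ∀ᵐ y : Fin n → ℝ, MvPolynomial.eval y P.leadingCoeff ≠ 0 := by
      rw [ae_iff]; simpa using hlead
    filter_upwards [hae] with y hy
    have hmap : P.map (MvPolynomial.eval y) ≠ 0 := by
      intro h
      apply hy
      rw [Polynomial.leadingCoeff, ← Polynomial.coeff_map, h, Polynomial.coeff_zero]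
    refine lintegral_eq_zero_of_ae_eq_zero ?_
    have hfin : {t : ℝ | (P.map (MvPolynomial.eval y)).eval t = 0}.Finite :=
      (P.map (MvPolynomial.eval y)).roots.toFinset.finite_toSet.subset fun t ht => by
        simpa [hmap] using ht
    have := measure_eq_zero_iff_ae_notMem.1 (hfin.measure_zero volume)
    filter_upwards [this] with t ht
    refine indicator_of_notMem ?_ _
    intro h
    apply ht
    have h' : MvPolynomial.eval ((0 : Fin (n + 1)).insertNth t y) p = 0 := h
    rw [Fin.insertNth_zero'] at h'
    rw [MvPolynomial.eval_eq_eval_mv_eval'] at h'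
    exact h'

/-! ### The variation of polynomials over slabs of values -/

/-- Between consecutive critical points `p` is injective, so by change of variables the integral of
`|p'|` over the part of the slab there is the length of an image inside `[0, ε]`. The number of
pieces is at most the degree plus one. -/
theorem lintegral_abs_deriv_slab_le (p : Polynomial ℝ) (ε : ℝ) :
    ∫⁻ t in {t | p.eval t ∈ Icc 0 ε}, ENNReal.ofReal |p.derivative.eval t| ≤
      (p.natDegree + 1 : ℕ) * ENNReal.ofReal ε := by
  classical
  rcases eq_or_ne p.derivative 0 with h0 | h0
  · simp [h0]
  set Z := p.derivative.roots.toFinset with hZ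
  have hZcard : Z.card ≤ p.natDegree :=
    (Multiset.toFinset_card_le _).trans ((Polynomial.card_roots' _).trans
      ((Polynomial.natDegree_derivative_le p).trans (Nat.sub_le _ _)))
  -- The number of critical points below `t`; its level sets are the pieces.
  set c : ℝ → ℕ := fun t => (Z.filter (· < t)).card with hc
  have hcmono : Monotone c := fun s t hst =>
    Finset.card_le_card fun z hz => by
      rw [Finset.mem_filter] at hz ⊢
      exact ⟨hz.1, hz.2.trans_le hst⟩
  set S := {t : ℝ | p.eval t ∈ Icc 0 ε} with hS
  have hSm : MeasurableSet S := (isClosed_Icc.preimage p.continuous).measurableSet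
  let B : Fin (Z.card + 1) → Set ℝ := fun k => S ∩ {t | c t = k}
  have hBm : ∀ k, MeasurableSet (B k) := fun k =>
    hSm.inter (hcmono.measurable (measurableSet_singleton (k : ℕ)))
  have hcover : S ⊆ ⋃ k, B k := fun t ht => mem_iUnion.2
    ⟨⟨c t, Nat.lt_succ_of_le (Finset.card_filter_le _ _)⟩, ht, rfl⟩
  have hinj : ∀ k, InjOn (fun t => p.eval t) (B k) := by
    intro k x hx y hy hxy
    by_contra hne
    wlog hlt : x < y generalizing x y
    · exact this hy hx hxy.symm (Ne.symm hne) (lt_of_le_of_ne (not_lt.1 hlt) (Ne.symm hne))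
    obtain ⟨z, hz, hdz⟩ := exists_deriv_eq_zero hlt p.continuous.continuousOn hxy
    rw [Polynomial.deriv] at hdz
    have hzZ : z ∈ Z := by
      rw [hZ, Multiset.mem_toFinset, Polynomial.mem_roots h0]
      exact hdz
    -- The Rolle point `z` between `x` and `y` is counted at `y` but not at `x`.
    have : c x < c y := by
      refine Finset.card_lt_card (Finset.ssubset_iff_of_subset ?_ |>.2 ⟨z, ?_, ?_⟩)
      · intro w hw
        rw [Finset.mem_filter] at hw ⊢
        exact ⟨hw.1, hw.2.trans hlt⟩
      · exact Finset.mem_filter.2 ⟨hzZ, hz.2⟩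
      · intro h
        exact absurd (Finset.mem_filter.1 h).2 (not_lt.2 hz.1.le)
    rw [hx.2, hy.2] at this
    exact lt_irrefl _ this
  have hpiece : ∀ k, ∫⁻ t in B k, ENNReal.ofReal |p.derivative.eval t| ≤ ENNReal.ofReal ε := by
    intro k
    have h := lintegral_image_eq_lintegral_abs_deriv_mul (hBm k)
      (fun x _ => (p.hasDerivAt x).hasDerivWithinAt) (hinj k) (fun _ => 1)
    simp only [mul_one, lintegral_const, Measure.restrict_apply MeasurableSet.univ, univ_inter,
      one_mul] at h
    rw [← h]
    calc volume ((fun t => p.eval t) '' B k) ≤ volume (Icc 0 ε) :=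
          measure_mono (image_subset_iff.2 fun t ht => ht.1)
      _ = ENNReal.ofReal ε := by rw [Real.volume_Icc, sub_zero]
  calc ∫⁻ t in S, ENNReal.ofReal |p.derivative.eval t|
      ≤ ∫⁻ t in ⋃ k, B k, ENNReal.ofReal |p.derivative.eval t| := lintegral_mono_set hcover
    _ ≤ ∑' k, ∫⁻ t in B k, ENNReal.ofReal |p.derivative.eval t| := lintegral_iUnion_le _ _
    _ ≤ ∑' _ : Fin (Z.card + 1), ENNReal.ofReal ε := ENNReal.tsum_le_tsum hpiece
    _ = (Z.card + 1 : ℕ) * ENNReal.ofReal ε := by simp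
    _ ≤ (p.natDegree + 1 : ℕ) * ENNReal.ofReal ε := by gcongr

/-- The restriction of a polynomial to the line in direction `j` through `y`. -/
noncomputable def lineRestrict {n : ℕ} (j : Fin (n + 1)) (y : Fin n → ℝ) :
    MvPolynomial (Fin (n + 1)) ℝ →ₐ[ℝ] Polynomial ℝ :=
  MvPolynomial.aeval (j.insertNth (α := fun _ => Polynomial ℝ) Polynomial.X
    fun i => Polynomial.C (y i))

theorem eval_lineRestrict {n : ℕ} (j : Fin (n + 1)) (y : Fin n → ℝ) (t : ℝ)
    (p : MvPolynomial (Fin (n + 1)) ℝ) :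
    (lineRestrict j y p).eval t = MvPolynomial.eval (j.insertNth t y) p := by
  induction p using MvPolynomial.induction_on with
  | C r => simp [lineRestrict]
  | add p q hp hq => simp [hp, hq]
  | mul_X p i hp =>
    rw [map_mul, Polynomial.eval_mul, hp, map_mul, MvPolynomial.eval_X]
    congr 1
    refine Fin.succAboveCases j ?_ (fun i => ?_) i <;> simp [lineRestrict]

theorem derivative_lineRestrict {n : ℕ} (j : Fin (n + 1)) (y : Fin n → ℝ)
    (p : MvPolynomial (Fin (n + 1)) ℝ) :
    (lineRestrict j y p).derivative = lineRestrict j y (MvPolynomial.pderiv j p) := by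
  induction p using MvPolynomial.induction_on with
  | C r => simp [lineRestrict]
  | add p q hp hq => simp [hp, hq]
  | mul_X p i hp =>
    rw [map_mul, Polynomial.derivative_mul, hp, MvPolynomial.pderiv_mul, map_add, map_mul, map_mul]
    congr 2
    refine Fin.succAboveCases j ?_ (fun i => ?_) i
    · simp [lineRestrict]
    · rw [MvPolynomial.pderiv_X_of_ne (Fin.succAbove_ne j i)]
      simp [lineRestrict]

theorem natDegree_lineRestrict_le {n : ℕ} (j : Fin (n + 1)) (y : Fin n → ℝ)
    (p : MvPolynomial (Fin (n + 1)) ℝ) : (lineRestrict j y p).natDegree ≤ p.totalDegree := by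
  rw [lineRestrict, MvPolynomial.aeval_def, MvPolynomial.eval₂_eq']
  refine Polynomial.natDegree_sum_le_of_forall_le _ _ fun d hd => ?_
  refine (Polynomial.natDegree_C_mul_le _ _).trans ?_
  refine (Polynomial.natDegree_prod_le _ _).trans ?_
  refine le_trans (Finset.sum_le_sum (g := fun i => d i) fun i _ => ?_) ?_
  · refine Polynomial.natDegree_pow_le.trans ?_
    refine mul_le_of_le_one_right (Nat.zero_le _) ?_
    refine Fin.succAboveCases j ?_ (fun i => ?_) i <;> simp
  · have := MvPolynomial.le_totalDegree hd
    rwa [Finsupp.sum_fintype _ _ (by simp)] at this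

/-- The integral of a partial derivative of a polynomial over a slab of values grows at most
linearly with the height of the slab. -/
theorem exists_lintegral_pderiv_slab_le {n : ℕ} (p : MvPolynomial (Fin n) ℝ) (j : Fin n) (B : ℝ) :
    ∃ C : ℝ, 0 ≤ C ∧ ∀ ε, ∫⁻ x in {x | (∀ i, x i ∈ Icc (-B) B) ∧ MvPolynomial.eval x p ∈ Icc 0 ε},
      ENNReal.ofReal |MvPolynomial.eval x (MvPolynomial.pderiv j p)| ≤
        ENNReal.ofReal C * ENNReal.ofReal ε := by
  obtain ⟨n, rfl⟩ : ∃ k, n = k + 1 := Nat.exists_eq_succ_of_ne_zero (by rintro rfl; exact j.elim0)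
  set box : Set (Fin n → ℝ) := univ.pi fun _ => Icc (-B) B with hbox
  have hboxm : MeasurableSet box := MeasurableSet.univ_pi fun _ => measurableSet_Icc
  have hboxfin : volume box ≠ ⊤ :=
    (isCompact_univ_pi fun _ => isCompact_Icc).measure_lt_top.ne
  -- Fubini along direction `j`: each line contributes at most `(deg p + 1) ε`, and the lines
  -- meeting the cube are indexed by a box of one dimension less.
  refine ⟨(p.totalDegree + 1 : ℕ) * volume.real box, by positivity, fun ε => ?_⟩
  set T := {x : Fin (n + 1) → ℝ | (∀ i, x i ∈ Icc (-B) B) ∧ MvPolynomial.eval x p ∈ Icc 0 ε} with hT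
  have hTm : MeasurableSet T := by
    refine MeasurableSet.inter (s₁ := {x : Fin (n + 1) → ℝ | ∀ i, x i ∈ Icc (-B) B}) ?_
      (isClosed_Icc.preimage (MvPolynomial.continuous_eval p)).measurableSet
    have e : {x : Fin (n + 1) → ℝ | ∀ i, x i ∈ Icc (-B) B} = univ.pi fun _ => Icc (-B) B := by
      ext x
      exact ⟨fun h i _ => h i, fun h i => h i trivial⟩
    rw [e]
    exact MeasurableSet.univ_pi fun _ => measurableSet_Icc
  have hfm : Measurable fun x : Fin (n + 1) → ℝ =>
      ENNReal.ofReal |MvPolynomial.eval x (MvPolynomial.pderiv j p)| :=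
    (MvPolynomial.continuous_eval _).abs.measurable.ennreal_ofReal
  rw [← lintegral_indicator hTm, lintegral_insertNth j (hfm.indicator hTm)]
  have hin : ∀ y : Fin n → ℝ, ∫⁻ t : ℝ, T.indicator (fun x =>
      ENNReal.ofReal |MvPolynomial.eval x (MvPolynomial.pderiv j p)|) (j.insertNth t y) ≤
        box.indicator (fun _ => (p.totalDegree + 1 : ℕ) * ENNReal.ofReal ε) y := by
    intro y
    by_cases hy : y ∈ box
    · rw [indicator_of_mem hy]
      refine le_trans ?_ ((lintegral_abs_deriv_slab_le (lineRestrict j y p) ε).trans ?_)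
      · rw [← lintegral_indicator
          (show MeasurableSet {t | (lineRestrict j y p).eval t ∈ Icc 0 ε} from
            (isClosed_Icc.preimage (lineRestrict j y p).continuous).measurableSet)]
        refine lintegral_mono fun t => ?_
        by_cases ht : j.insertNth t y ∈ T
        · rw [indicator_of_mem ht, indicator_of_mem
            (show t ∈ {t | (lineRestrict j y p).eval t ∈ Icc 0 ε} by
              rw [mem_ofPred_eq, eval_lineRestrict]; exact ht.2),
            derivative_lineRestrict, eval_lineRestrict]
        · rw [indicator_of_notMem ht]; exact zero_le
      · have := natDegree_lineRestrict_le j y p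
        gcongr
    · rw [indicator_of_notMem hy]
      refine (lintegral_eq_zero_of_ae_eq_zero (Eventually.of_forall fun t => ?_)).le
      refine indicator_of_notMem (fun h => hy fun i _ => ?_) _
      have := h.1 (j.succAbove i)
      simpa using this
  calc _ ≤ ∫⁻ y, box.indicator (fun _ => (p.totalDegree + 1 : ℕ) * ENNReal.ofReal ε) y :=
        lintegral_mono hin
    _ = (p.totalDegree + 1 : ℕ) * ENNReal.ofReal ε * volume box := by
        rw [lintegral_indicator hboxm, setLIntegral_const]
    _ = _ := by
        rw [ENNReal.ofReal_mul (by positivity), ENNReal.ofReal_natCast, Measure.real,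
          ENNReal.ofReal_toReal hboxfin]
        ring

/-! ### The divergence theorem on basic semialgebraic sets -/

section Stokes

variable {n N : ℕ}

theorem isClosed_basicSet (G : Fin N → MvPolynomial (Fin n) ℝ) : IsClosed (basicSet G) := by
  have e : basicSet G = ⋂ i, {y | 0 ≤ MvPolynomial.eval y (G i)} := by ext; simp [basicSet]
  rw [e]
  exact isClosed_iInter fun i => isClosed_le continuous_const (MvPolynomial.continuous_eval _)

theorem exists_integral_pderiv_slab_le (p : MvPolynomial (Fin n) ℝ) (j : Fin n) (B : ℝ) :
    ∃ C : ℝ, 0 ≤ C ∧ ∀ ε, 0 ≤ ε →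
      ∫ x in {x | (∀ i, x i ∈ Icc (-B) B) ∧ MvPolynomial.eval x p ∈ Icc 0 ε},
        |MvPolynomial.eval x (MvPolynomial.pderiv j p)| ≤ C * ε := by
  obtain ⟨C, hC, h⟩ := exists_lintegral_pderiv_slab_le p j B
  refine ⟨C, hC, fun ε hε => ?_⟩
  rw [integral_eq_lintegral_of_nonneg_ae (Eventually.of_forall fun _ => abs_nonneg _)
    (MvPolynomial.continuous_eval _).abs.aestronglyMeasurable]
  refine ENNReal.toReal_le_of_le_ofReal (by positivity) ?_
  rw [ENNReal.ofReal_mul hC]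
  exact h ε

theorem isCompact_slab (p : MvPolynomial (Fin n) ℝ) (B ε : ℝ) :
    IsCompact {x : Fin n → ℝ | (∀ i, x i ∈ Icc (-B) B) ∧ MvPolynomial.eval x p ∈ Icc 0 ε} := by
  have e : {x : Fin n → ℝ | (∀ i, x i ∈ Icc (-B) B) ∧ MvPolynomial.eval x p ∈ Icc 0 ε} =
      (univ.pi fun _ => Icc (-B) B) ∩ (fun x => MvPolynomial.eval x p) ⁻¹' Icc 0 ε := by
    ext x
    exact ⟨fun h => ⟨fun i _ => h.1 i, h.2⟩, fun h => ⟨fun i => h.1 i trivial, h.2⟩⟩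
  rw [e]
  exact (isCompact_univ_pi fun _ => isCompact_Icc).inter_right
    (isClosed_Icc.preimage (MvPolynomial.continuous_eval p))

/-- A field that points outwards on the regular part of a face and vanishes on its singular part
points almost outwards near the face. -/
theorem exists_slab_outward {K : Set (Fin n → ℝ)} (hK : IsCompact K) {p : MvPolynomial (Fin n) ℝ}
    {U : Fin n → MvPolynomial (Fin n) ℝ}
    (h₁ : ∀ y ∈ K, MvPolynomial.eval y p = 0 →
      ∑ j, MvPolynomial.eval y (U j) * MvPolynomial.eval y (MvPolynomial.pderiv j p) ≤ 0)
    (h₂ : ∀ y ∈ K, MvPolynomial.eval y p = 0 →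
      (∀ j, MvPolynomial.eval y (MvPolynomial.pderiv j p) = 0) →
      ∀ j, MvPolynomial.eval y (U j) = 0) {η : ℝ} (hη : 0 < η) :
    ∃ ε₀ > 0, ∀ y ∈ K, MvPolynomial.eval y p ∈ Icc 0 ε₀ →
      ∑ j, MvPolynomial.eval y (U j) * MvPolynomial.eval y (MvPolynomial.pderiv j p) ≤
        η * ∑ j, |MvPolynomial.eval y (MvPolynomial.pderiv j p)| := by
  -- Violating points with `p → 0` accumulate, by compactness, at some `a ∈ K` with `p(a) = 0`.
  by_contra! hcon
  have hpos : ∀ k : ℕ, (0 : ℝ) < 1 / ((k : ℝ) + 1) := fun k => by positivity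
  choose y hyK hyp hy using fun k : ℕ => hcon _ (hpos k)
  obtain ⟨a, haK, σ, hσ, hlim⟩ := hK.tendsto_subseq hyK
  have hev : ∀ q : MvPolynomial (Fin n) ℝ,
      Tendsto (fun k => MvPolynomial.eval (y (σ k)) q) atTop (𝓝 (MvPolynomial.eval a q)) :=
    fun q => ((MvPolynomial.continuous_eval q).tendsto a).comp hlim
  have hpa : MvPolynomial.eval a p = 0 := by
    refine tendsto_nhds_unique (hev p) (squeeze_zero (fun k => (hyp (σ k)).1)
      (fun k => (hyp (σ k)).2) ?_)
    exact tendsto_one_div_add_atTop_nhds_zero_nat.comp hσ.tendsto_atTop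
  by_cases hcrit : ∀ j, MvPolynomial.eval a (MvPolynomial.pderiv j p) = 0
  -- At a critical point `a` the field vanishes, so `|U_j| < η` nearby and the estimate holds term
  -- by term.
  · have hU := h₂ a haK hpa hcrit
    have hsmall : ∀ᶠ k in atTop, ∀ j, |MvPolynomial.eval (y (σ k)) (U j)| < η := by
      refine eventually_all.2 fun j => ?_
      have := (hev (U j)).abs
      rw [hU j, abs_zero] at this
      exact this.eventually (gt_mem_nhds hη)
    obtain ⟨k, hk⟩ := hsmall.exists
    refine absurd (hy (σ k)) (not_lt.2 ?_)
    rw [Finset.mul_sum]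
    refine Finset.sum_le_sum fun j _ => ?_
    calc _ ≤ |MvPolynomial.eval (y (σ k)) (U j)| *
          |MvPolynomial.eval (y (σ k)) (MvPolynomial.pderiv j p)| := by
          rw [← abs_mul]; exact le_abs_self _
      _ ≤ _ := by gcongr; exact (hk j).le
  -- At a regular point the limit of the violated inequalities reads `η ∑ |∂_j p| ≤ U · ∇p ≤ 0`,
  -- although the left side is positive.
  · push Not at hcrit
    obtain ⟨j₀, hj₀⟩ := hcrit
    have l1 := tendsto_finsetSum Finset.univ fun j _ =>
      (hev (U j)).mul (hev (MvPolynomial.pderiv j p))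
    have l2 := (tendsto_finsetSum Finset.univ fun j _ =>
      (hev (MvPolynomial.pderiv j p)).abs).const_mul η
    have hle := le_of_tendsto_of_tendsto l2 l1 (Eventually.of_forall fun k => (hy (σ k)).le)
    have hpos : 0 < ∑ j, |MvPolynomial.eval a (MvPolynomial.pderiv j p)| :=
      Finset.sum_pos' (fun _ _ => abs_nonneg _) ⟨j₀, Finset.mem_univ _, abs_pos.2 hj₀⟩
    have := h₁ a haK hpa
    have := mul_pos hη hpos
    linarith

/-! ### Line derivatives, integration by parts and smooth cutoffs -/

theorem hasLineDerivAt_eval (p : MvPolynomial (Fin n) ℝ) (j : Fin n) (y : Fin n → ℝ) :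
    HasLineDerivAt ℝ (fun y => MvPolynomial.eval y p)
      (MvPolynomial.eval y (MvPolynomial.pderiv j p)) y (Pi.single j 1) := by
  unfold HasLineDerivAt
  induction p using MvPolynomial.induction_on with
  | C r => simpa using hasDerivAt_const (0 : ℝ) r
  | add p q hp hq => simpa using hp.fun_add hq
  | mul_X p i hp =>
    have hX : HasDerivAt (fun t : ℝ => y i + t * (Pi.single j (1 : ℝ) : Fin n → ℝ) i)
        ((Pi.single j (1 : ℝ) : Fin n → ℝ) i) 0 := by
      simpa using ((hasDerivAt_id (0 : ℝ)).mul_const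
        ((Pi.single j (1 : ℝ) : Fin n → ℝ) i)).const_add (y i)
    have h := hp.fun_mul hX
    simp only [zero_smul, add_zero, zero_mul] at h
    have e : (fun t : ℝ => MvPolynomial.eval (y + t • (Pi.single j 1 : Fin n → ℝ))
        (p * MvPolynomial.X i)) = fun t : ℝ =>
        MvPolynomial.eval (y + t • (Pi.single j 1 : Fin n → ℝ)) p *
          (y i + t * (Pi.single j (1 : ℝ) : Fin n → ℝ) i) := by
      funext t; simp
    rw [e]
    refine h.congr_deriv ?_
    rw [MvPolynomial.pderiv_mul, MvPolynomial.pderiv_X]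
    simp only [map_add, map_mul, MvPolynomial.eval_X]
    rcases eq_or_ne i j with rfl | hij
    · simp
    · simp [hij]

/-- Integration by parts against the constant function 1. -/
theorem integral_lineDeriv_eq_zero {f f' : (Fin n → ℝ) → ℝ} {v : Fin n → ℝ} (hf : Integrable f)
    (hf' : Integrable f') (h : ∀ y, HasLineDerivAt ℝ f (f' y) y v) : ∫ y, f' y = 0 := by
  have := integral_bilinear_hasLineDerivAt_right_eq_neg_left_of_integrable (μ := volume)
    (f := fun _ : Fin n → ℝ => (1 : ℝ)) (f' := fun _ => 0) (g := f) (g' := f') (v := v)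
    (B := ContinuousLinearMap.mul ℝ ℝ) (by simp) (by simpa using hf') (by simpa using hf)
    (fun x _ => hasDerivAt_const _ _) (fun x _ => h x)
  simpa using this

/-- A smooth cutoff of the set where all `G i` are nonnegative. -/
noncomputable def cutoff (G : Fin N → MvPolynomial (Fin n) ℝ) (ε : ℝ) (y : Fin n → ℝ) : ℝ :=
  ∏ i, Real.smoothTransition (MvPolynomial.eval y (G i) / ε)

/-- The weight with which the gradient of `G i` enters the gradient of the cutoff. -/
noncomputable def cutoffWeight (G : Fin N → MvPolynomial (Fin n) ℝ) (ε : ℝ) (i : Fin N)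
    (y : Fin n → ℝ) : ℝ :=
  (∏ k ∈ Finset.univ.erase i, Real.smoothTransition (MvPolynomial.eval y (G k) / ε)) *
    deriv Real.smoothTransition (MvPolynomial.eval y (G i) / ε)

theorem continuous_deriv_smoothTransition : Continuous (deriv Real.smoothTransition) :=
  (Real.smoothTransition.contDiff (n := 1)).continuous_deriv le_rfl

theorem deriv_smoothTransition_of_notMem {s : ℝ} (hs : s ∉ Icc (0 : ℝ) 1) :
    deriv Real.smoothTransition s = 0 := by
  rw [mem_Icc, not_and_or, not_le, not_le] at hs
  rcases hs with hs | hs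
  · have : Real.smoothTransition =ᶠ[𝓝 s] fun _ => 0 := by
      filter_upwards [Iio_mem_nhds hs] with t ht using Real.smoothTransition.zero_of_nonpos ht.le
    rw [this.deriv_eq]; simp
  · have : Real.smoothTransition =ᶠ[𝓝 s] fun _ => 1 := by
      filter_upwards [Ioi_mem_nhds hs] with t ht using Real.smoothTransition.one_of_one_le ht.le
    rw [this.deriv_eq]; simp

theorem exists_deriv_smoothTransition_le : ∃ C : ℝ, 0 ≤ C ∧
    ∀ s, deriv Real.smoothTransition s ≤ C := by
  obtain ⟨C, hC⟩ := (isCompact_Icc (a := (0 : ℝ)) (b := 1)).bddAbove_image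
    continuous_deriv_smoothTransition.continuousOn
  refine ⟨max C 0, le_max_right _ _, fun s => ?_⟩
  by_cases hs : s ∈ Icc (0 : ℝ) 1
  · exact (hC (mem_image_of_mem _ hs)).trans (le_max_left _ _)
  · rw [deriv_smoothTransition_of_notMem hs]; exact le_max_right _ _

variable {G : Fin N → MvPolynomial (Fin n) ℝ} {ε : ℝ}

theorem continuous_cutoff : Continuous (cutoff G ε) :=
  continuous_finsetProd _ fun i _ => Real.smoothTransition.continuous.comp
    ((MvPolynomial.continuous_eval (G i)).div_const ε)

theorem continuous_cutoffWeight (i : Fin N) : Continuous (cutoffWeight G ε i) :=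
  (continuous_finsetProd _ fun k _ => Real.smoothTransition.continuous.comp
    ((MvPolynomial.continuous_eval (G k)).div_const ε)).mul
    (continuous_deriv_smoothTransition.comp ((MvPolynomial.continuous_eval (G i)).div_const ε))

theorem cutoff_nonneg (y : Fin n → ℝ) : 0 ≤ cutoff G ε y :=
  Finset.prod_nonneg fun _ _ => Real.smoothTransition.nonneg _

theorem cutoff_le_one (y : Fin n → ℝ) : cutoff G ε y ≤ 1 :=
  Finset.prod_le_one (fun _ _ => Real.smoothTransition.nonneg _)
    fun _ _ => Real.smoothTransition.le_one _

theorem cutoffWeight_nonneg (i : Fin N) (y : Fin n → ℝ) : 0 ≤ cutoffWeight G ε i y :=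
  mul_nonneg (Finset.prod_nonneg fun _ _ => Real.smoothTransition.nonneg _)
    (Real.smoothTransition.monotone.deriv_nonneg)

theorem cutoffWeight_le {C : ℝ} (hC : ∀ s, deriv Real.smoothTransition s ≤ C) (i : Fin N)
    (y : Fin n → ℝ) : cutoffWeight G ε i y ≤ C :=
  (mul_le_of_le_one_left Real.smoothTransition.monotone.deriv_nonneg
    (Finset.prod_le_one (fun _ _ => Real.smoothTransition.nonneg _)
      fun _ _ => Real.smoothTransition.le_one _)).trans (hC _)

theorem cutoff_eq_zero (hε : 0 < ε) {y : Fin n → ℝ} (hy : ∃ i, MvPolynomial.eval y (G i) ≤ 0) :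
    cutoff G ε y = 0 := by
  obtain ⟨i, hi⟩ := hy
  exact Finset.prod_eq_zero (Finset.mem_univ i)
    (Real.smoothTransition.zero_of_nonpos (div_nonpos_of_nonpos_of_nonneg hi hε.le))

theorem cutoff_eq_zero_of_notMem (hε : 0 < ε) {y : Fin n → ℝ} (hy : y ∉ basicSet G) :
    cutoff G ε y = 0 := by
  simp only [basicSet, mem_ofPred_eq, not_forall, not_le] at hy
  exact cutoff_eq_zero hε (hy.imp fun i hi => hi.le)

/-- If another constraint is violated, its factor in the product vanishes; if `G i` is outside `[0,
ε]`, the derivative of the transition does. -/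
theorem cutoffWeight_eq_zero (hε : 0 < ε) (i : Fin N) {y : Fin n → ℝ}
    (hy : ¬(y ∈ basicSet G ∧ MvPolynomial.eval y (G i) ∈ Icc 0 ε)) : cutoffWeight G ε i y = 0 := by
  by_cases hi : MvPolynomial.eval y (G i) ∈ Icc 0 ε
  · simp only [hi, and_true, basicSet, mem_ofPred_eq, not_forall, not_le] at hy
    obtain ⟨k, hk⟩ := hy
    have hki : k ≠ i := by rintro rfl; exact absurd hi.1 (not_le.2 hk)
    rw [cutoffWeight, Finset.prod_eq_zero (Finset.mem_erase.2 ⟨hki, Finset.mem_univ k⟩)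
      (Real.smoothTransition.zero_of_nonpos (div_nonpos_of_nonpos_of_nonneg hk.le hε.le)), zero_mul]
  · rw [cutoffWeight, deriv_smoothTransition_of_notMem, mul_zero]
    rwa [mem_Icc, le_div_iff₀ hε, div_le_iff₀ hε, zero_mul, one_mul]

theorem hasLineDerivAt_cutoff (j : Fin n) (y : Fin n → ℝ) :
    HasLineDerivAt ℝ (cutoff G ε)
      (∑ i, cutoffWeight G ε i y * MvPolynomial.eval y (MvPolynomial.pderiv j (G i)) / ε) y
      (Pi.single j 1) := by
  unfold HasLineDerivAt
  have h : ∀ i ∈ Finset.univ, HasDerivAt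
      (fun t : ℝ => Real.smoothTransition
        (MvPolynomial.eval (y + t • (Pi.single j 1 : Fin n → ℝ)) (G i) / ε))
      (deriv Real.smoothTransition (MvPolynomial.eval y (G i) / ε) *
        (MvPolynomial.eval y (MvPolynomial.pderiv j (G i)) / ε)) 0 := by
    intro i _
    have h1 := (hasLineDerivAt_eval (G i) j y).div_const ε
    have h2 : HasDerivAt Real.smoothTransition
        (deriv Real.smoothTransition (MvPolynomial.eval y (G i) / ε))
        (MvPolynomial.eval (y + (0 : ℝ) • (Pi.single j 1 : Fin n → ℝ)) (G i) / ε) := by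
      rw [zero_smul, add_zero]
      exact ((Real.smoothTransition.contDiff (n := 1)).differentiable one_ne_zero _).hasDerivAt
    exact h2.comp (0 : ℝ) h1
  have := HasDerivAt.fun_finsetProd h
  simp only [zero_smul, add_zero, smul_eq_mul] at this
  refine this.congr_deriv (Finset.sum_congr rfl fun i _ => ?_)
  rw [cutoffWeight]; ring

/-- Integration by parts moves the derivative onto the cutoff, producing `ε⁻¹` times integrals of `U
· ∇G i` over slabs of height `ε`. The slab estimate `C ε` cancels the `ε⁻¹`, so the bound does not
depend on `ε` and is proportional to `η`. -/
theorem integral_cutoff_div_ge (hε : 0 < ε) {B : ℝ}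
    (hB : ∀ y ∈ basicSet G, ∀ j, y j ∈ Icc (-B) B) {U : Fin n → MvPolynomial (Fin n) ℝ}
    {C : Fin N → Fin n → ℝ} (hC : ∀ i j, ∀ ε, 0 ≤ ε →
      ∫ x in {x | (∀ i, x i ∈ Icc (-B) B) ∧ MvPolynomial.eval x (G i) ∈ Icc 0 ε},
        |MvPolynomial.eval x (MvPolynomial.pderiv j (G i))| ≤ C i j * ε)
    {M : ℝ} (hM₀ : 0 ≤ M) (hM : ∀ s, deriv Real.smoothTransition s ≤ M) {η : ℝ} (hη : 0 ≤ η)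
    (hout : ∀ i, ∀ y ∈ basicSet G, MvPolynomial.eval y (G i) ∈ Icc 0 ε →
      ∑ j, MvPolynomial.eval y (U j) * MvPolynomial.eval y (MvPolynomial.pderiv j (G i)) ≤
        η * ∑ j, |MvPolynomial.eval y (MvPolynomial.pderiv j (G i))|) :
    -(M * η * ∑ i, ∑ j, C i j) ≤
      ∫ y, cutoff G ε y * ∑ j, MvPolynomial.eval y (MvPolynomial.pderiv j (U j)) := by
  have hK : IsCompact (basicSet G) :=
    IsCompact.of_isClosed_subset (isCompact_univ_pi fun _ => isCompact_Icc) (isClosed_basicSet G)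
      fun y hy j _ => hB y hy j
  have hcs : ∀ f : (Fin n → ℝ) → ℝ, Continuous f → (∀ y ∉ basicSet G, f y = 0) →
      Integrable f := fun f hf h0 =>
    hf.integrable_of_hasCompactSupport (HasCompactSupport.intro hK h0)
  have hint1 : ∀ p : MvPolynomial (Fin n) ℝ,
      Integrable fun y => cutoff G ε y * MvPolynomial.eval y p := fun p =>
    hcs _ (continuous_cutoff.mul (MvPolynomial.continuous_eval p)) fun y hy => by
      rw [cutoff_eq_zero_of_notMem hε hy, zero_mul]
  have hint2 : ∀ i (p : MvPolynomial (Fin n) ℝ),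
      Integrable fun y => cutoffWeight G ε i y * MvPolynomial.eval y p := fun i p =>
    hcs _ ((continuous_cutoffWeight i).mul (MvPolynomial.continuous_eval p)) fun y hy => by
      rw [cutoffWeight_eq_zero hε i (fun h => hy h.1), zero_mul]
  have hpart : ∀ j, ∫ y, cutoff G ε y * MvPolynomial.eval y (MvPolynomial.pderiv j (U j)) =
      -∑ i, ε⁻¹ * ∫ y, cutoffWeight G ε i y *
        MvPolynomial.eval y (U j * MvPolynomial.pderiv j (G i)) := by
    intro j
    have hi : Integrable fun y => ∑ i, ε⁻¹ * (cutoffWeight G ε i y *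
        MvPolynomial.eval y (U j * MvPolynomial.pderiv j (G i))) :=
      integrable_finsetSum _ fun i _ => (hint2 i _).const_mul _
    have h := integral_lineDeriv_eq_zero (v := Pi.single j 1) (hint1 (U j))
      (hi.add (hint1 (MvPolynomial.pderiv j (U j)))) fun y => by
        have h1 := hasLineDerivAt_cutoff (G := G) (ε := ε) j y
        have h2 := hasLineDerivAt_eval (U j) j y
        unfold HasLineDerivAt at h1 h2 ⊢
        refine (h1.fun_mul h2).congr_deriv ?_
        simp only [zero_smul, add_zero, Finset.sum_mul, Pi.add_apply, map_mul]
        congr 1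
        refine Finset.sum_congr rfl fun i _ => ?_
        rw [div_eq_mul_inv]; ring
    rw [integral_add' hi (hint1 _), integral_finsetSum _ fun i _ => (hint2 i _).const_mul _] at h
    simp only [integral_const_mul] at h
    linarith
  have hsum : ∫ y, cutoff G ε y * ∑ j, MvPolynomial.eval y (MvPolynomial.pderiv j (U j)) =
      -∑ i, ε⁻¹ * ∫ y, cutoffWeight G ε i y *
        ∑ j, MvPolynomial.eval y (U j) * MvPolynomial.eval y (MvPolynomial.pderiv j (G i)) := by
    simp only [Finset.mul_sum]
    rw [integral_finsetSum _ fun j _ => hint1 _, Finset.sum_congr rfl fun j _ => hpart j,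
      Finset.sum_neg_distrib, Finset.sum_comm]
    congr 1
    refine Finset.sum_congr rfl fun i _ => ?_
    rw [integral_finsetSum, ← Finset.mul_sum]
    · simp only [map_mul]
    · intro j _
      simpa only [map_mul] using hint2 i (U j * MvPolynomial.pderiv j (G i))
  have hbound : ∀ i, ∫ y, cutoffWeight G ε i y *
      ∑ j, MvPolynomial.eval y (U j) * MvPolynomial.eval y (MvPolynomial.pderiv j (G i)) ≤
        M * η * ((∑ j, C i j) * ε) := by
    intro i
    set T := {x | (∀ i, x i ∈ Icc (-B) B) ∧ MvPolynomial.eval x (G i) ∈ Icc 0 ε} with hT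
    have hTc : IsCompact T := isCompact_slab (G i) B ε
    have hTi : ∀ j, IntegrableOn (fun y => |MvPolynomial.eval y (MvPolynomial.pderiv j (G i))|) T :=
      fun j => (MvPolynomial.continuous_eval _).abs.continuousOn.integrableOn_compact hTc
    have hTs : IntegrableOn (fun y => M * η *
        ∑ j, |MvPolynomial.eval y (MvPolynomial.pderiv j (G i))|) T :=
      (integrable_finsetSum _ fun j _ => hTi j).const_mul _
    calc _ ≤ ∫ y, T.indicator (fun y => M * η *
            ∑ j, |MvPolynomial.eval y (MvPolynomial.pderiv j (G i))|) y := by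
          refine integral_mono ?_ (hTs.integrable_indicator hTc.measurableSet) fun y => ?_
          · have := hint2 i (∑ j, U j * MvPolynomial.pderiv j (G i))
            simpa only [map_sum, map_mul] using this
          · have hnn : 0 ≤ M * η * ∑ j, |MvPolynomial.eval y (MvPolynomial.pderiv j (G i))| :=
              mul_nonneg (mul_nonneg hM₀ hη) (Finset.sum_nonneg fun _ _ => abs_nonneg _)
            -- On the slab the weight lies between 0 and `M`; elsewhere it vanishes.
            by_cases hy : y ∈ basicSet G ∧ MvPolynomial.eval y (G i) ∈ Icc 0 ε
            · have hyT : y ∈ T := ⟨hB y hy.1, hy.2⟩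
              rw [indicator_of_mem hyT, mul_assoc]
              have h0 := cutoffWeight_nonneg (G := G) (ε := ε) i y
              have h1 := cutoffWeight_le (G := G) (ε := ε) hM i y
              refine (mul_le_mul_of_nonneg_left (hout i y hy.1 hy.2) h0).trans
                (mul_le_mul_of_nonneg_right h1 (mul_nonneg hη
                  (Finset.sum_nonneg fun _ _ => abs_nonneg _)))
            · simp only [cutoffWeight_eq_zero hε i hy, zero_mul]
              exact indicator_nonneg (fun x _ => mul_nonneg (mul_nonneg hM₀ hη)
                (Finset.sum_nonneg fun _ _ => abs_nonneg _)) y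
      _ = M * η * ∑ j, ∫ y in T, |MvPolynomial.eval y (MvPolynomial.pderiv j (G i))| := by
          rw [integral_indicator hTc.measurableSet, integral_const_mul,
            integral_finsetSum _ fun j _ => hTi j]
      _ ≤ M * η * ∑ j, C i j * ε := by
          refine mul_le_mul_of_nonneg_left (Finset.sum_le_sum fun j _ => hC i j ε hε.le)
            (mul_nonneg hM₀ hη)
      _ = _ := by rw [Finset.sum_mul]
  rw [hsum, neg_le_neg_iff, Finset.mul_sum]
  refine Finset.sum_le_sum fun i _ => ?_
  calc _ ≤ ε⁻¹ * (M * η * ((∑ j, C i j) * ε)) :=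
        mul_le_mul_of_nonneg_left (hbound i) (inv_nonneg.2 hε.le)
    _ = _ := by field_simp

/-- The divergence inequality: on a compact basic semialgebraic set, the divergence of a polynomial
field pointing outwards on the regular part of the boundary and vanishing on its singular part has
nonnegative integral. -/
theorem integral_div_nonneg {B : ℝ} (hB : ∀ y ∈ basicSet G, ∀ j, y j ∈ Icc (-B) B)
    {U : Fin n → MvPolynomial (Fin n) ℝ}
    (h₁ : ∀ i, ∀ y ∈ basicSet G, MvPolynomial.eval y (G i) = 0 →
      ∑ j, MvPolynomial.eval y (U j) * MvPolynomial.eval y (MvPolynomial.pderiv j (G i)) ≤ 0)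
    (h₂ : ∀ i, ∀ y ∈ basicSet G, MvPolynomial.eval y (G i) = 0 →
      (∀ j, MvPolynomial.eval y (MvPolynomial.pderiv j (G i)) = 0) →
      ∀ j, MvPolynomial.eval y (U j) = 0) :
    0 ≤ ∫ y in basicSet G, ∑ j, MvPolynomial.eval y (MvPolynomial.pderiv j (U j)) := by
  have hK : IsCompact (basicSet G) :=
    IsCompact.of_isClosed_subset (isCompact_univ_pi fun _ => isCompact_Icc) (isClosed_basicSet G)
      fun y hy j _ => hB y hy j
  -- If some `G i` is the zero polynomial, every point of the set is singular for it, so `U`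
  -- vanishes on the whole set. Then either the set is null or each `U j` is the zero polynomial.
  by_cases hG : ∃ i, G i = 0
  · obtain ⟨i, hi⟩ := hG
    have hU : ∀ y ∈ basicSet G, ∀ j, MvPolynomial.eval y (U j) = 0 := fun y hy =>
      h₂ i y hy (by simp [hi]) (by simp [hi])
    by_cases hvol : volume (basicSet G) = 0
    · rw [setIntegral_measure_zero _ hvol]
    · have hU0 : ∀ j, U j = 0 := fun j => by
        by_contra hne
        exact hvol (measure_mono_null (fun y hy => hU y hy j) (volume_zeros_eq_zero hne))
      simp [hU0]
  push Not at hG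
  obtain ⟨M, hM₀, hM⟩ := exists_deriv_smoothTransition_le
  choose C hC₀ hC using fun i j => exists_integral_pderiv_slab_le (G i) j B
  have hδ : ∀ k : ℕ, (0 : ℝ) < 1 / ((k : ℝ) + 1) := fun k => by positivity
  set D : (Fin n → ℝ) → ℝ := fun y => ∑ j, MvPolynomial.eval y (MvPolynomial.pderiv j (U j)) with hD
  have hDc : Continuous D := continuous_finsetSum _ fun j _ => MvPolynomial.continuous_eval _
  have hlim : Tendsto (fun k : ℕ => ∫ y, cutoff G (1 / ((k : ℝ) + 1)) y * D y) atTop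
      (𝓝 (∫ y in basicSet G, D y)) := by
    rw [← integral_indicator hK.measurableSet]
    refine tendsto_integral_of_dominated_convergence ((basicSet G).indicator fun y => |D y|)
      (fun k => (continuous_cutoff.mul hDc).aestronglyMeasurable)
      ((hDc.abs.continuousOn.integrableOn_compact hK).integrable_indicator hK.measurableSet)
      (fun k => Eventually.of_forall fun y => ?_) ?_
    · by_cases hy : y ∈ basicSet G
      · rw [indicator_of_mem hy, norm_mul, Real.norm_of_nonneg (cutoff_nonneg y), Real.norm_eq_abs]
        exact mul_le_of_le_one_left (abs_nonneg _) (cutoff_le_one y)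
      · rw [cutoff_eq_zero_of_notMem (hδ k) hy, zero_mul, norm_zero, indicator_of_notMem hy]
    -- Almost everywhere no `G i` vanishes, so on the set the cutoff is eventually 1.
    · have hne : ∀ᵐ y : Fin n → ℝ, ∀ i, MvPolynomial.eval y (G i) ≠ 0 := by
        refine ae_all_iff.2 fun i => ?_
        rw [ae_iff]
        simpa using volume_zeros_eq_zero (hG i)
      filter_upwards [hne] with y hy
      by_cases hyK : y ∈ basicSet G
      · rw [indicator_of_mem hyK]
        refine tendsto_const_nhds.congr' ?_
        have : ∀ᶠ k : ℕ in atTop, ∀ i, 1 / ((k : ℝ) + 1) < MvPolynomial.eval y (G i) :=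
          eventually_all.2 fun i => tendsto_one_div_add_atTop_nhds_zero_nat.eventually
            (gt_mem_nhds (lt_of_le_of_ne (hyK i) (hy i).symm))
        filter_upwards [this] with k hk
        have : cutoff G (1 / ((k : ℝ) + 1)) y = 1 := Finset.prod_eq_one fun i _ =>
          Real.smoothTransition.one_of_one_le ((one_le_div (hδ k)).2 (hk i).le)
        rw [this, one_mul]
      · rw [indicator_of_notMem hyK]
        refine tendsto_const_nhds.congr fun k => ?_
        rw [cutoff_eq_zero_of_notMem (hδ k) hyK, zero_mul]
  -- The order of limits matters: the height of the slabs tends to 0 with `η` fixed, and `η` tends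
  -- to 0 afterwards.
  have hlow : ∀ η : ℝ, 0 < η → -(M * η * ∑ i, ∑ j, C i j) ≤ ∫ y in basicSet G, D y := by
    intro η hη
    choose e he hout using fun i => exists_slab_outward hK (h₁ i) (h₂ i) hη
    refine ge_of_tendsto hlim ?_
    have : ∀ᶠ k : ℕ in atTop, ∀ i, 1 / ((k : ℝ) + 1) < e i := eventually_all.2 fun i =>
      tendsto_one_div_add_atTop_nhds_zero_nat.eventually (gt_mem_nhds (he i))
    filter_upwards [this] with k hk
    exact integral_cutoff_div_ge (hδ k) hB hC hM₀ hM hη.le fun i y hy hyi =>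
      hout i y hy ⟨hyi.1, hyi.2.trans (hk i).le⟩
  have hlim0 : Tendsto (fun η : ℝ => -(M * η * ∑ i, ∑ j, C i j)) (𝓝[>] 0) (𝓝 0) := by
    have : Continuous fun η : ℝ => -(M * η * ∑ i, ∑ j, C i j) := by fun_prop
    have h := this.tendsto 0
    simp only [mul_zero, zero_mul, neg_zero] at h
    exact h.mono_left nhdsWithin_le_nhds
  exact le_of_tendsto hlim0 (eventually_nhdsWithin_of_forall fun η hη => hlow η hη)

end Stokes
/-! ### Restriction to slices and symmetrisation -/

section Slices

variable {m N : ℕ} {R : ℝ}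

/-- The restriction of a polynomial to the slice given by `q`. -/
noncomputable def sliceHom (q : FrameVar m → ℝ) :
    MvPolynomial (SliceVar m) ℝ →ₐ[ℝ] MvPolynomial (Fin m) ℝ :=
  MvPolynomial.aeval (Sum.elim (fun v => MvPolynomial.C (q v)) MvPolynomial.X)

theorem eval_sliceHom (q : FrameVar m → ℝ) (y : Fin m → ℝ) (p : MvPolynomial (SliceVar m) ℝ) :
    MvPolynomial.eval y (sliceHom q p) = MvPolynomial.eval (joinPoint q y) p := by
  induction p using MvPolynomial.induction_on with
  | C r => simp [sliceHom]
  | add p q hp hq => simp [hp, hq]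
  | mul_X p v hp =>
    rw [map_mul, map_mul, hp, map_mul, MvPolynomial.eval_X]
    congr 1
    rcases v with v | j <;> simp [sliceHom, joinPoint]

theorem pderiv_sliceHom (q : FrameVar m → ℝ) (j : Fin m) (p : MvPolynomial (SliceVar m) ℝ) :
    MvPolynomial.pderiv j (sliceHom q p) = sliceHom q (MvPolynomial.pderiv (coordVar j) p) := by
  classical
  induction p using MvPolynomial.induction_on with
  | C r => simp [sliceHom]
  | add p q hp hq => simp [hp, hq]
  | mul_X p v hp =>
    rw [map_mul, MvPolynomial.pderiv_mul, MvPolynomial.pderiv_mul, map_add, map_mul, map_mul, hp]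
    congr 2
    rcases v with v | k
    · rw [MvPolynomial.pderiv_X_of_ne (by simp [coordVar])]
      simp [sliceHom]
    · rcases eq_or_ne k j with rfl | hkj
      · simp [sliceHom, coordVar]
      · rw [MvPolynomial.pderiv_X_of_ne (by simpa [coordVar] using hkj)]
        simp [sliceHom, MvPolynomial.pderiv_X_of_ne hkj]

/-- The substitution `z ↦ -z`. -/
noncomputable def negHom :
    MvPolynomial (SliceVar m) ℝ →ₐ[ℝ] MvPolynomial (SliceVar m) ℝ :=
  MvPolynomial.bind₁ fun v => -MvPolynomial.X v

theorem pderiv_negHom (v : SliceVar m) (p : MvPolynomial (SliceVar m) ℝ) :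
    MvPolynomial.pderiv v (negHom p) = -negHom (MvPolynomial.pderiv v p) := by
  classical
  induction p using MvPolynomial.induction_on with
  | C r => simp [negHom]
  | add p q hp hq => simp only [map_add, hp, hq, neg_add]
  | mul_X p w hp =>
    have hX : negHom (MvPolynomial.X w) = (-MvPolynomial.X w : MvPolynomial (SliceVar m) ℝ) := by
      simp [negHom]
    rw [map_mul, MvPolynomial.pderiv_mul, MvPolynomial.pderiv_mul, map_add, map_mul, map_mul, hp,
      hX, map_neg]
    rcases eq_or_ne w v with rfl | hwv
    · simp; ring
    · rw [MvPolynomial.pderiv_X_of_ne hwv]; simp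

/-- Every term of `θ t + Z y` is a product of two variables, so the reflection fixes it. -/
theorem negHom_pull (g : MvPolynomial (Fin (m + 1)) ℝ) : negHom (pull g) = pull g := by
  rw [negHom, pull, MvPolynomial.bind₁_bind₁]
  congr 2
  funext i
  simp [slicePoint]

/-- The odd part of a polynomial. -/
noncomputable def oddPart (f : MvPolynomial (SliceVar m) ℝ) : MvPolynomial (SliceVar m) ℝ :=
  MvPolynomial.C (1 / 2) * (f - negHom f)

/-- Differentiation anticommutes with the reflection, so the even part of the divergence is the
divergence of the odd part of the field. The same holds for `dotGradY`, and the averages disappear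
from the constraints. -/
theorem symm_divY (u : Fin m → MvPolynomial (SliceVar m) ℝ) :
    symm (divY u) = divY fun j => oddPart (u j) := by
  change MvPolynomial.C (1 / 2) * (divY u + negHom (divY u)) = _
  simp only [divY, oddPart, MvPolynomial.pderiv_C_mul, map_sub, pderiv_negHom, sub_neg_eq_add,
    map_sum, ← Finset.sum_add_distrib, Finset.mul_sum]

theorem symm_dotGradY (u : Fin m → MvPolynomial (SliceVar m) ℝ)
    (g : MvPolynomial (Fin (m + 1)) ℝ) :
    symm (dotGradY u g) = dotGradY (fun j => oddPart (u j)) g := by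
  have h : ∀ j, negHom (MvPolynomial.pderiv (coordVar j) (pull g)) =
      -MvPolynomial.pderiv (coordVar j) (pull g) := fun j => by
    rw [← neg_eq_iff_eq_neg, ← pderiv_negHom, negHom_pull]
  change MvPolynomial.C (1 / 2) * (dotGradY u g + negHom (dotGradY u g)) = _
  simp only [dotGradY, oddPart, map_sum, map_mul, h, ← Finset.sum_add_distrib, Finset.mul_sum]
  refine Finset.sum_congr rfl fun j _ => ?_
  ring

theorem pderiv_bind₁ {σ τ : Type*} [Fintype σ] (F : σ → MvPolynomial τ ℝ) (v : τ)
    (p : MvPolynomial σ ℝ) :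
    MvPolynomial.pderiv v (MvPolynomial.bind₁ F p) =
      ∑ i, MvPolynomial.bind₁ F (MvPolynomial.pderiv i p) * MvPolynomial.pderiv v (F i) := by
  classical
  induction p using MvPolynomial.induction_on with
  | C r => simp
  | add p q hp hq => simp [hp, hq, add_mul, Finset.sum_add_distrib]
  | mul_X p k hp =>
    rw [map_mul, MvPolynomial.pderiv_mul, hp]
    simp only [MvPolynomial.pderiv_mul, map_add, map_mul, add_mul, Finset.sum_add_distrib,
      MvPolynomial.bind₁_X_right, MvPolynomial.pderiv_X, Finset.sum_mul]
    congr 1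
    · exact Finset.sum_congr rfl fun i _ => by ring
    · rw [Finset.sum_eq_single k]
      · simp
      · intro i _ hik
        simp [hik]
      · simp

/-- The chain rule for `g (θ t + Z y)`. -/
theorem eval_pderiv_pull (g : MvPolynomial (Fin (m + 1)) ℝ) (j : Fin m) (z : SliceVar m → ℝ) :
    MvPolynomial.eval z (MvPolynomial.pderiv (coordVar j) (pull g)) =
      ∑ i, z (Sum.inl (frameVar i j)) *
        MvPolynomial.eval (slicePoint z) (MvPolynomial.pderiv i g) := by
  classical
  have h : ∀ i, MvPolynomial.pderiv (coordVar j)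
      (slicePoint (MvPolynomial.X : SliceVar m → MvPolynomial (SliceVar m) ℝ) i) =
      MvPolynomial.X (Sum.inl (frameVar i j)) := by
    intro i
    simp only [slicePoint, map_add, map_sum, MvPolynomial.pderiv_mul]
    rw [MvPolynomial.pderiv_X_of_ne (by simp [coordVar]),
      MvPolynomial.pderiv_X_of_ne (by simp [coordVar]), Finset.sum_eq_single j]
    · rw [MvPolynomial.pderiv_X_of_ne (by simp [coordVar])]; simp
    · intro k _ hkj
      rw [MvPolynomial.pderiv_X_of_ne (by simp [coordVar]),
        MvPolynomial.pderiv_X_of_ne (by simpa [coordVar] using hkj)]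
      simp
    · simp
  rw [pull, pderiv_bind₁, map_sum]
  refine Finset.sum_congr rfl fun i _ => ?_
  rw [h, map_mul, MvPolynomial.eval_X, mul_comm]
  congr 1
  exact eval_pull _ z

/-! ### Orthogonal frames -/

theorem slicePoint_eq_mulVec (z : SliceVar m → ℝ) :
    slicePoint z = frameMatrix (framePart z) *ᵥ
      (Fin.cons (z (Sum.inl offsetVar)) (coordPart z) : Fin (m + 1) → ℝ) := by
  funext i
  simp [slicePoint, Matrix.mulVec, dotProduct, Fin.sum_univ_succ, frameMatrix, framePart, coordPart]

theorem sum_sq_slicePoint {z : SliceVar m → ℝ}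
    (hz : frameMatrix (framePart z) ∈ Matrix.orthogonalGroup (Fin (m + 1)) ℝ) :
    ∑ i, slicePoint z i ^ 2 = z (Sum.inl offsetVar) ^ 2 + ∑ j, coordPart z j ^ 2 := by
  have h := (Matrix.mem_orthogonalGroup_iff' _ _).1 hz
  set v : Fin (m + 1) → ℝ := Fin.cons (z (Sum.inl offsetVar)) (coordPart z) with hv
  have e1 : ∑ i, slicePoint z i ^ 2 = slicePoint z ⬝ᵥ slicePoint z := by simp [dotProduct, sq]
  have e2 : v ⬝ᵥ v = z (Sum.inl offsetVar) ^ 2 + ∑ j, coordPart z j ^ 2 := by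
    simp [dotProduct, Fin.sum_univ_succ, hv, sq]
  rw [e1, ← e2, slicePoint_eq_mulVec, ← hv, Matrix.dotProduct_mulVec, Matrix.vecMul_mulVec]
  rw [h, Matrix.vecMul_one]

/-- An orthogonal frame gives `t² + ‖y‖² = ‖θ t + Z y‖² ≤ R²`, so the bounds on `t` and `y` are
automatic. Rotating the frame over a fixed point of `L` therefore stays in `Ψ_L`. -/
theorem mem_PsiL_of_frame {L : Set (Fin (m + 1) → ℝ)} (hR : 0 ≤ R) (hL : L ⊆ ball (m + 1) R)
    {z : SliceVar m → ℝ}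
    (hz : frameMatrix (framePart z) ∈ Matrix.orthogonalGroup (Fin (m + 1)) ℝ)
    (hzL : slicePoint z ∈ L) : z ∈ PsiL R L := by
  have h1 : ∑ i, slicePoint z i ^ 2 ≤ R ^ 2 := hL hzL
  rw [sum_sq_slicePoint hz] at h1
  have h2 : 0 ≤ ∑ j, coordPart z j ^ 2 := Finset.sum_nonneg fun _ _ => sq_nonneg _
  have h3 := sq_nonneg (z (Sum.inl offsetVar))
  refine ⟨⟨(mem_OmegaZ_iff _ hR).2 ⟨?_, ?_⟩, ?_⟩, hzL⟩
  · simp only [offsetIneq, map_sub, map_pow, MvPolynomial.eval_C, MvPolynomial.eval_X, framePart]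
    linarith
  · intro e
    rw [eval_orthEq, sub_eq_zero]
    have h := (Matrix.mem_orthogonalGroup_iff' _ _).1 hz
    rw [← h]
  · change ∑ j, coordPart z j ^ 2 ≤ R ^ 2
    linarith

/-- The rotation by the angle `s` of the frame in the plane of `θ` and `Z_j`, with the coordinates
`t` and `y_j` adapted so that the point `θ t + Z y` stays fixed. -/
noncomputable def rotateFrame (z : SliceVar m → ℝ) (j : Fin m) (s : ℝ) : SliceVar m → ℝ :=
  Sum.elim
    (Sum.elim
      (Sum.elim
        (fun i => Real.cos s * z (Sum.inl (thetaVar i)) + Real.sin s * z (Sum.inl (frameVar i j)))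
        fun _ => Real.cos s * z (Sum.inl offsetVar) + Real.sin s * z (coordVar j))
      fun p => if p.2 = j then
        -Real.sin s * z (Sum.inl (thetaVar p.1)) + Real.cos s * z (Sum.inl (frameVar p.1 j))
        else z (Sum.inl (frameVar p.1 p.2)))
    fun k => if k = j then -Real.sin s * z (Sum.inl offsetVar) + Real.cos s * z (coordVar j)
      else z (coordVar k)

theorem rotateFrame_zero (z : SliceVar m → ℝ) (j : Fin m) : rotateFrame z j 0 = z := by
  funext v
  rcases v with ((i | ⟨⟩) | ⟨i, k⟩) | k
  · simp [rotateFrame, thetaVar]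
  · simp [rotateFrame, offsetVar]
  · by_cases h : k = j <;> simp [rotateFrame, frameVar, h]
  · by_cases h : k = j <;> simp [rotateFrame, coordVar, h]

theorem continuous_rotateFrame (z : SliceVar m → ℝ) (j : Fin m) :
    Continuous (rotateFrame z j) := by
  refine continuous_pi fun v => ?_
  rcases v with ((i | ⟨⟩) | ⟨i, k⟩) | k
  · simp only [rotateFrame, Sum.elim_inl]; fun_prop
  · simp only [rotateFrame, Sum.elim_inl, Sum.elim_inr]; fun_prop
  · by_cases h : k = j <;> simp only [rotateFrame, Sum.elim_inl, Sum.elim_inr, h, if_true, if_false]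
      <;> fun_prop
  · by_cases h : k = j <;> simp only [rotateFrame, Sum.elim_inr, h, if_true, if_false] <;> fun_prop

/-- The pairs `(θ, Z_j)` and `(t, y_j)` undergo the same plane rotation, which preserves `θ t + Z_j
y_j`. -/
theorem slicePoint_rotateFrame (z : SliceVar m → ℝ) (j : Fin m) (s : ℝ) :
    slicePoint (rotateFrame z j s) = slicePoint z := by
  funext i
  simp only [slicePoint]
  rw [← Finset.add_sum_erase _ _ (Finset.mem_univ j),
    ← Finset.add_sum_erase _ _ (Finset.mem_univ j)]
  have e : ∑ k ∈ Finset.univ.erase j, rotateFrame z j s (Sum.inl (frameVar i k)) *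
      rotateFrame z j s (coordVar k) =
      ∑ k ∈ Finset.univ.erase j, z (Sum.inl (frameVar i k)) * z (coordVar k) :=
    Finset.sum_congr rfl fun k hk => by
      simp [rotateFrame, frameVar, coordVar, Finset.ne_of_mem_erase hk]
  rw [e]
  simp only [rotateFrame, thetaVar, offsetVar, frameVar, coordVar, Sum.elim_inl, Sum.elim_inr,
    if_true]
  linear_combination (z (Sum.inl (Sum.inl (Sum.inl i))) * z (Sum.inl (Sum.inl (Sum.inr ()))) +
    z (Sum.inl (Sum.inr (i, j))) * z (Sum.inr j)) * Real.sin_sq_add_cos_sq s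

theorem sum_lincomb_mul {ι : Type*} [Fintype ι] (a b c d : ι → ℝ) (x y x' y' : ℝ) :
    ∑ i, (x * a i + y * b i) * (x' * c i + y' * d i) = x * x' * ∑ i, a i * c i +
      x * y' * ∑ i, a i * d i + y * x' * ∑ i, b i * c i + y * y' * ∑ i, b i * d i := by
  simp only [Finset.mul_sum, ← Finset.sum_add_distrib]
  exact Finset.sum_congr rfl fun i _ => by ring

theorem mem_orthogonalGroup_rotateFrame {z : SliceVar m → ℝ} (j : Fin m) (s : ℝ)
    (hz : frameMatrix (framePart z) ∈ Matrix.orthogonalGroup (Fin (m + 1)) ℝ) :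
    frameMatrix (framePart (rotateFrame z j s)) ∈ Matrix.orthogonalGroup (Fin (m + 1)) ℝ := by
  set A := frameMatrix (framePart z) with hA'
  set A' := frameMatrix (framePart (rotateFrame z j s)) with hB'
  have hA : ∀ k l, ∑ i, A i k * A i l = if k = l then 1 else 0 := by
    intro k l
    have h := congrFun (congrFun ((Matrix.mem_orthogonalGroup_iff' _ _).1 hz) k) l
    rwa [Matrix.mul_apply, Matrix.one_apply] at h
  have h0 : ∀ i, A' i 0 = Real.cos s * A i 0 + Real.sin s * A i j.succ := fun i => rfl
  have hj : ∀ i, A' i j.succ = -Real.sin s * A i 0 + Real.cos s * A i j.succ := fun i => by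
    simp [hA', hB', frameMatrix, framePart, rotateFrame, frameVar]
  -- The unrotated columns are written as trivial linear combinations so that `sum_lincomb_mul`
  -- covers all nine cases.
  have hk : ∀ k, k ≠ j → ∀ i, A' i k.succ = 1 * A i k.succ + 0 * A i k.succ := fun k hk i => by
    simp [hA', hB', frameMatrix, framePart, rotateFrame, frameVar, hk]
  have hcases : ∀ l : Fin (m + 1), l = 0 ∨ l = j.succ ∨ ∃ k, k ≠ j ∧ l = k.succ := fun l => by
    refine Fin.cases (Or.inl rfl) (fun k => ?_) l
    by_cases hkj : k = j
    · exact Or.inr (Or.inl (by rw [hkj]))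
    · exact Or.inr (Or.inr ⟨k, hkj, rfl⟩)
  have hsc := Real.sin_sq_add_cos_sq s
  rw [Matrix.mem_orthogonalGroup_iff']
  ext k l
  rw [Matrix.mul_apply, Matrix.one_apply]
  change ∑ i, A' i k * A' i l = _
  rcases hcases k with rfl | rfl | ⟨k, hkj, rfl⟩ <;> rcases hcases l with rfl | rfl | ⟨l, hlj, rfl⟩
  · simp only [h0, sum_lincomb_mul, hA, Fin.succ_ne_zero, (Fin.succ_ne_zero _).symm, if_true,
      if_false]
    linarith
  · simp only [h0, hj, sum_lincomb_mul, hA, Fin.succ_ne_zero, (Fin.succ_ne_zero _).symm, if_true,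
      if_false]
    ring
  · simp only [h0, hk l hlj, sum_lincomb_mul, hA, (Fin.succ_ne_zero _).symm, Fin.succ_inj,
      hlj.symm, if_false]
    ring
  · simp only [h0, hj, sum_lincomb_mul, hA, Fin.succ_ne_zero, (Fin.succ_ne_zero _).symm, if_true,
      if_false]
    ring
  · simp only [hj, sum_lincomb_mul, hA, Fin.succ_ne_zero, (Fin.succ_ne_zero _).symm, if_true,
      if_false]
    linarith
  · simp only [hj, hk l hlj, sum_lincomb_mul, hA, (Fin.succ_ne_zero _).symm, Fin.succ_inj,
      hlj.symm, if_false]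
    ring
  · simp only [h0, hk k hkj, sum_lincomb_mul, hA, Fin.succ_ne_zero, Fin.succ_inj, hkj, if_false]
    ring
  · simp only [hj, hk k hkj, sum_lincomb_mul, hA, Fin.succ_ne_zero, Fin.succ_inj, hkj, if_false]
    ring
  · simp only [hk k hkj, hk l hlj, sum_lincomb_mul, hA]
    ring

/-- A field pointing outwards on a face of `Ψ_L` vanishes where the slice is tangent to the face. -/
theorem eval_eq_zero_of_tangent {g : Fin N → MvPolynomial (Fin (m + 1)) ℝ} (hR : 0 ≤ R)
    (hL : basicSet g ⊆ ball (m + 1) R) {i : Fin N}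
    (hGrad : ∀ x ∈ basicSet g, MvPolynomial.eval x (g i) = 0 →
      ∃ j, MvPolynomial.eval x (MvPolynomial.pderiv j (g i)) ≠ 0)
    {v : Fin m → MvPolynomial (SliceVar m) ℝ}
    (hv : ∀ z ∈ PsiL R (basicSet g), MvPolynomial.eval z (pull (g i)) = 0 →
      MvPolynomial.eval z (dotGradY v (g i)) ≤ 0) {z : SliceVar m → ℝ}
    (hz : z ∈ PsiL R (basicSet g)) (hzi : MvPolynomial.eval z (pull (g i)) = 0)
    (htan : ∀ j, MvPolynomial.eval z (MvPolynomial.pderiv (coordVar j) (pull (g i))) = 0)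
    (j : Fin m) : MvPolynomial.eval z (v j) = 0 := by
  have horth := hz.1.1.2.2
  set a : Fin (m + 1) → ℝ := fun l =>
    MvPolynomial.eval (slicePoint z) (MvPolynomial.pderiv l (g i)) with ha
  set c : ℝ := ∑ l, z (Sum.inl (thetaVar l)) * a l with hc
  have htan' : ∀ k, ∑ l, z (Sum.inl (frameVar l k)) * a l = 0 := fun k => by
    rw [← htan k, eval_pderiv_pull]
  -- At a tangency the gradient is orthogonal to every column of `Z`; were it also orthogonal to
  -- `θ`, it would vanish, against `hGrad`.
  have hc0 : c ≠ 0 := by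
    intro h0
    have hT : (frameMatrix (framePart z))ᵀ *ᵥ a = 0 := by
      funext k
      refine Fin.cases ?_ (fun k => ?_) k
      · simpa [Matrix.mulVec, dotProduct, frameMatrix, framePart] using h0
      · simpa [Matrix.mulVec, dotProduct, frameMatrix, framePart] using htan' k
    have h1 := (Matrix.mem_orthogonalGroup_iff _ _).1 horth
    have h2 : a = 0 := by
      rw [← Matrix.one_mulVec a, ← h1, ← Matrix.mulVec_mulVec, hT, Matrix.mulVec_zero]
    obtain ⟨l, hl⟩ := hGrad _ hz.2 (by rwa [← eval_pull])
    exact hl (congrFun h2 l)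
  -- The rotated point lies over the same boundary point, and there the `y`-gradient is `-sin s · c`
  -- in direction `j` and zero in the others. The boundary inequality thus isolates the single
  -- component `v j`.
  have hrot : ∀ s, 0 ≤ Real.sin s * (c * MvPolynomial.eval (rotateFrame z j s) (v j)) := by
    intro s
    have hmem : rotateFrame z j s ∈ PsiL R (basicSet g) :=
      mem_PsiL_of_frame hR hL (mem_orthogonalGroup_rotateFrame j s horth)
        (by rw [slicePoint_rotateFrame]; exact hz.2)
    have h := hv _ hmem (by rw [eval_pull, slicePoint_rotateFrame, ← eval_pull]; exact hzi)
    have hd : ∀ k, MvPolynomial.eval (rotateFrame z j s)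
        (MvPolynomial.pderiv (coordVar k) (pull (g i))) = if k = j then -Real.sin s * c else 0 := by
      intro k
      rw [eval_pderiv_pull, slicePoint_rotateFrame]
      by_cases hk : k = j
      · subst hk
        have e : ∀ l, rotateFrame z k s (Sum.inl (frameVar l k)) * a l =
            -Real.sin s * (z (Sum.inl (thetaVar l)) * a l) +
              Real.cos s * (z (Sum.inl (frameVar l k)) * a l) := fun l => by
          simp only [rotateFrame, frameVar, Sum.elim_inl, Sum.elim_inr, if_true]; ring
        rw [if_pos rfl, Finset.sum_congr rfl fun l _ => e l, Finset.sum_add_distrib,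
          ← Finset.mul_sum, ← Finset.mul_sum, htan', mul_zero, add_zero]
      · rw [if_neg hk, ← htan' k]
        exact Finset.sum_congr rfl fun l _ => by simp [rotateFrame, frameVar, hk, ha]
    simp only [dotGradY, map_sum, map_mul, hd, mul_ite, mul_zero, Finset.sum_ite_eq',
      Finset.mem_univ, if_true] at h
    linarith
  set f : ℝ → ℝ := fun s => c * MvPolynomial.eval (rotateFrame z j s) (v j) with hf
  have hfc : Continuous f := continuous_const.mul
    ((MvPolynomial.continuous_eval (v j)).comp (continuous_rotateFrame z j))
  -- As `sin s` changes sign at 0, the one-sided limits give `f 0 ≥ 0` and `f 0 ≤ 0`.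
  have h1 : 0 ≤ f 0 := by
    refine ge_of_tendsto ((hfc.tendsto 0).mono_left nhdsWithin_le_nhds : Tendsto f (𝓝[>] 0) _) ?_
    filter_upwards [Ioo_mem_nhdsGT Real.pi_pos] with s hs
    exact nonneg_of_mul_nonneg_right (hrot s) (Real.sin_pos_of_pos_of_lt_pi hs.1 hs.2)
  have h2 : f 0 ≤ 0 := by
    refine le_of_tendsto ((hfc.tendsto 0).mono_left nhdsWithin_le_nhds : Tendsto f (𝓝[<] 0) _) ?_
    filter_upwards [Ioo_mem_nhdsLT (neg_lt_zero.2 Real.pi_pos)] with s hs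
    have hs' := Real.sin_neg_of_neg_of_neg_pi_lt hs.2 hs.1
    have := hrot s
    by_contra hpos
    exact absurd (mul_neg_of_neg_of_pos hs' (not_le.1 hpos)) (not_lt.2 this)
  have h3 : c * MvPolynomial.eval z (v j) = 0 := by
    have := le_antisymm h2 h1
    simpa only [hf, rotateFrame_zero] using this
  exact (mul_eq_zero.1 h3).resolve_left hc0

/-! ### The lower bound -/

/-- Integrating `w ≥ 1 + div v` over the slice, where the divergence contributes a nonnegative
amount, and using `w ≥ 0` on the rest of the ball, the volume is at most `Λ_R w ≤ γ`. -/
theorem volume_slice_le {g : Fin N → MvPolynomial (Fin (m + 1)) ℝ} (hR : 0 ≤ R)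
    (hL : basicSet g ⊆ ball (m + 1) R)
    (hGrad : ∀ i, ∀ x ∈ basicSet g, MvPolynomial.eval x (g i) = 0 →
      ∃ j, MvPolynomial.eval x (MvPolynomial.pderiv j (g i)) ≠ 0)
    {k : ℕ} {γ : ℝ} {w : MvPolynomial (SliceVar m) ℝ} {u : Fin m → MvPolynomial (SliceVar m) ℝ}
    (hfeas : StokesSOSFeasible R g k γ w u) {q : FrameVar m → ℝ} (hq : q ∈ OmegaZ m R) :
    volume.real {y ∈ ball m R | slicePoint (joinPoint q y) ∈ basicSet g} ≤ γ := by
  set v : Fin m → MvPolynomial (SliceVar m) ℝ := fun j => oddPart (u j) with hv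
  set G : Fin N → MvPolynomial (Fin m) ℝ := fun i => sliceHom q (pull (g i)) with hG
  have hpsi : ∀ y, y ∈ basicSet G → joinPoint q y ∈ PsiL R (basicSet g) := fun y hy =>
    mem_PsiL_of_frame hR hL hq.2.2 fun i => by
      have := hy i
      rwa [hG, eval_sliceHom, eval_pull] at this
  have hset : {y ∈ ball m R | slicePoint (joinPoint q y) ∈ basicSet g} = basicSet G := by
    ext y
    refine ⟨fun h i => ?_, fun h => ⟨(hpsi y h).1.2, (hpsi y h).2⟩⟩
    rw [hG, eval_sliceHom, eval_pull]
    exact h.2 i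
  have hball : basicSet G ⊆ ball m R := fun y hy => (hpsi y hy).1.2
  have hKm : MeasurableSet (basicSet G) := (isClosed_basicSet G).measurableSet
  have hK : IsCompact (basicSet G) :=
    (isCompact_ball m hR).of_isClosed_subset (isClosed_basicSet G) hball
  have hface : ∀ i, ∀ z ∈ PsiL R (basicSet g), MvPolynomial.eval z (pull (g i)) = 0 →
      MvPolynomial.eval z (dotGradY v (g i)) ≤ 0 := by
    intro i z hz hzi
    obtain ⟨h1, h2⟩ := (mem_PsiL_iff g z hR).1 hz
    have h := WSOS.eval_nonneg (hfeas.boundary i) h1 (by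
      rintro (e | ⟨⟩)
      · exact h2 e
      · exact hzi)
    rw [symm_dotGradY, map_neg] at h
    linarith
  have hdiv : 0 ≤ ∫ y in basicSet G,
      ∑ j, MvPolynomial.eval y (MvPolynomial.pderiv j (sliceHom q (v j))) := by
    refine integral_div_nonneg (B := R)
      (fun y hy j => abs_le.1 (abs_le_of_mem_ball hR (hball hy) j))
      (fun i y hy hyi => ?_) fun i y hy hyi hcrit j => ?_
    · rw [hG, eval_sliceHom] at hyi
      have := hface i _ (hpsi y hy) hyi
      simpa only [hG, pderiv_sliceHom, eval_sliceHom, dotGradY, map_sum, map_mul] using this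
    -- A critical point of the restricted constraint on its face is a tangency of the hyperplane
    -- with the face of `L`.
    · rw [hG, eval_sliceHom] at hyi
      rw [eval_sliceHom]
      refine eval_eq_zero_of_tangent hR hL (hGrad i) (hface i) (hpsi y hy) hyi (fun k => ?_) j
      have := hcrit k
      rwa [hG, pderiv_sliceHom, eval_sliceHom] at this
  have hstokes : ∀ y ∈ basicSet G,
      1 + ∑ j, MvPolynomial.eval y (MvPolynomial.pderiv j (sliceHom q (v j))) ≤
        MvPolynomial.eval (joinPoint q y) w := by
    intro y hy
    obtain ⟨h1, h2⟩ := (mem_PsiL_iff g _ hR).1 (hpsi y hy)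
    have h := WSOS.eval_nonneg hfeas.stokes h1 h2
    rw [symm_divY] at h
    simp only [map_sub, map_one, divY, map_sum] at h
    simp only [pderiv_sliceHom, eval_sliceHom]
    linarith
  have hdc : Continuous fun y : Fin m → ℝ =>
      ∑ j, MvPolynomial.eval y (MvPolynomial.pderiv j (sliceHom q (v j))) :=
    continuous_finsetSum _ fun j _ => MvPolynomial.continuous_eval _
  have hdi := hdc.continuousOn.integrableOn_compact (μ := volume) hK
  have hone : IntegrableOn (fun _ : Fin m → ℝ => (1 : ℝ)) (basicSet G) :=
    integrableOn_const hK.measure_lt_top.ne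
  have hwi := integrableOn_eval_slice hR w q
  obtain ⟨Q, hQ, hQe⟩ := hfeas.integral_le
  have hQ0 : 0 ≤ MvPolynomial.eval q Q := by
    obtain ⟨h1, h2⟩ := (mem_OmegaZ_iff q hR).1 hq
    exact WSOS.eval_nonneg hQ (fun _ => h1) h2
  rw [hQe] at hQ0
  rw [hset]
  calc volume.real (basicSet G) = ∫ _ in basicSet G, (1 : ℝ) := by
        rw [setIntegral_const, smul_eq_mul, mul_one]
    _ ≤ (∫ _ in basicSet G, (1 : ℝ)) + ∫ y in basicSet G,
          ∑ j, MvPolynomial.eval y (MvPolynomial.pderiv j (sliceHom q (v j))) := by linarith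
    _ = ∫ y in basicSet G, (1 +
          ∑ j, MvPolynomial.eval y (MvPolynomial.pderiv j (sliceHom q (v j)))) :=
        (integral_add hone hdi).symm
    _ ≤ ∫ y in basicSet G, MvPolynomial.eval (joinPoint q y) w :=
        setIntegral_mono_on (hone.add hdi) (hwi.mono_set hball) hKm hstokes
    _ ≤ ∫ y in ball m R, MvPolynomial.eval (joinPoint q y) w := by
        refine setIntegral_mono_set hwi ?_ (Eventually.of_forall hball)
        refine (ae_restrict_iff' (isCompact_ball m hR).measurableSet).2
          (Eventually.of_forall fun y hy => ?_)
        obtain ⟨h1, h2⟩ := (mem_Psi_iff _ hR).1 (joinPoint_mem_Psi hq hy)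
        exact WSOS.eval_nonneg hfeas.nonneg h1 h2
    _ ≤ γ := by
        change Lam R (fun z => MvPolynomial.eval z w) q ≤ γ
        linarith

theorem pStar_le_pStarStokesSOS {g : Fin N → MvPolynomial (Fin (m + 1)) ℝ} (hR : 0 ≤ R)
    (hL : basicSet g ⊆ ball (m + 1) R)
    (hGrad : ∀ i, ∀ x ∈ basicSet g, MvPolynomial.eval x (g i) = 0 →
      ∃ j, MvPolynomial.eval x (MvPolynomial.pderiv j (g i)) ≠ 0) (k : ℕ) :
    pStar R (basicSet g) ≤ pStarStokesSOS R g k := by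
  refine le_sInf ?_
  rintro _ ⟨γ, w, u, hfeas, rfl⟩
  exact pStar_le hR (isCompact_PsiL g hR).isClosed fun q hq =>
    volume_slice_le hR hL hGrad hfeas hq

end Slices

end SliceVolume

/-- Here `n = m + 1`, the set is `L = {x ∈ ℝⁿ | g i x ≥ 0 for all i}`, and `hGrad` is the condition
that `∇ g i ≠ 0` on the face of `L` where `g i = 0`. -/
theorem mainTheorem6 (m N : ℕ) (R : ℝ) (hR : 0 ≤ R)
    (g : Fin N → MvPolynomial (Fin (m + 1)) ℝ)
    (hBounded : SliceVolume.basicSet g ⊆ SliceVolume.ball (m + 1) R)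
    (hBall : ∃ i, g i = MvPolynomial.C (R ^ 2) - ∑ j, MvPolynomial.X j ^ 2)
    (hDomain : SliceVolume.IsStandardDomain (interior (SliceVolume.basicSet g)))
    (hGrad : ∀ i, ∀ x ∈ SliceVolume.basicSet g, MvPolynomial.eval x (g i) = 0 →
      ∃ j, MvPolynomial.eval x (MvPolynomial.pderiv j (g i)) ≠ 0) :
    Filter.Tendsto (fun k : ℕ => SliceVolume.pStarStokesSOS R g k) Filter.atTop
      (nhds (SliceVolume.pStar R (SliceVolume.basicSet g))) := by
  -- The values below `p*` are excluded for every `k`. For `b > p*`, a feasible `γ < b` and a real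
  -- `c` strictly between them leave the slack that the approximation needs.
  refine tendsto_order.2 ⟨fun a ha => Eventually.of_forall fun k =>
    ha.trans_le (SliceVolume.pStar_le_pStarStokesSOS hR hBounded hGrad k), fun b hb => ?_⟩
  obtain ⟨_, ⟨γ, w, hfeas, rfl⟩, hγb⟩ := sInf_lt_iff.1 hb
  obtain ⟨c, hγc, hcb⟩ := EReal.lt_iff_exists_real_btwn.1 hγb
  filter_upwards [SliceVolume.eventually_pStarStokesSOS_le hR g hfeas
    (EReal.coe_lt_coe_iff.1 hγc)] with k hk
  exact hk.trans_lt hcb
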